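/- Let $V$ be a Euclidean Jordan algebra: a finite-dimensional real vector space with a commutative bilinear product $\bullet$, satisfying $x^2\bullet(y\bullet x)=(x^2\bullet y)\bullet x$, with unit $u$, and admitting an inner product for which all operators $L_x y=x\bullet y$ are symmetric. Let $V_+=\{x^2: x\in V\}$, write $x\le y$ if $y-x\in V_+$, and equip $V$ with the spectral (order-unit) norm $\|x\|_u=\inf\{\lambda\ge 0: -\lambda u\le x\le\lambda u\}$. For $y\in V$ let $h_y(z)=\|z-y\|_u-\|y\|_u$, let $\overline V^h$ be the closure of $\{h_y:y\in V\}$ in $\mathbb R^V$ for pointwise convergence (basepoint $0$), and call the elements of $\overline V^h\setminus\{h_y:y\in V\}$ horofunctions. For horofunctions $h,h'$ the detour cost is $H(h,h')=\sup_W\inf\{\|x\|_u+h'(x): x\in V,\ h_x\in W\}$, the supremum being over neighbourhoods $W$ of $h$ in $\overline V^h$, and the detour distance is $\delta(h,h')=H(h,h')+H(h',h)\in[0,\infty]$. A Busemann point is a horofunction that is the pointwise limit of $h_{x^\alpha}$ for some almost geodesic net $(x^\alpha)$, i.e. a net for which there is $w\in V$ such that for every $\varepsilon>0$ there is $\gamma$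 with $\|x^\alpha-x^{\alpha'}\|_u+\|x^{\alpha'}-w\|_u-\|x^\alpha-w\|_u<\varepsilon$ whenever $\alpha\ge\alpha'\ge\gamma$. Two functions are in the same part if they are Busemann points with $\delta(h,h')<\infty$; $\mathcal P_h$ denotes the part of $h$. A Jordan frame of $V$ is a family $p_1,\dots,p_r$ of primitive idempotents (nonzero idempotents that are not a sum of two nonzero idempotents) with $p_i\bullet p_j=0$ for $i\ne j$ and $p_1+\dots+p_r=u$. Put $U_xy=2x\bullet(x\bullet y)-x^2\bullet y$, $p_I=\sum_{i\in I}p_i$ (so $p_\emptyset=0$), $V(p)=U_p(V)$ for an idempotent $p$, and $V(p,q)=V(p)+V(q)$ for orthogonal idempotents $p,q$; these are subalgebras with units $p$ and $p+q$. For a subalgebra $W$ with unit $e\neq 0$ and $z\in W$ let $\Lambda_W(z)=\inf\{\lambda\in\mathbb R:\lambda e-z\in\{y^2:y\in W\}\}$ be the maximal eigenvalue of $z$ in $W$. On $V(p,q)$ with $p+q\ne0$ let $\|x\|_{\rm var}=\Lambda_{V(p,q)}(x)+\Lambda_{V(p,q)}(-x)$; it induces a norm on $V(p,q)/\mathbb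 R(p+q)$. **Theorem.** Let $p_1,\dots,p_r$ and $q_1,\dots,q_r$ be Jordan frames of $V$, let $I,J\subseteq\{1,\dots,r\}$ be disjoint with $I\cup J\neq\emptyset$, let $I',J'\subseteq\{1,\dots,r\}$ be disjoint with $I'\cup J'\ne\emptyset$, and let $\alpha\in\mathbb R^{I\cup J}$, $\beta\in\mathbb R^{I'\cup J'}$ satisfy $\min\alpha=0=\min\beta$. Let $$h(x)=\max\Big\{\Lambda_{V(p_I)}\Big(-U_{p_I}x-\sum_{i\in I}\alpha_ip_i\Big),\ \Lambda_{V(p_J)}\Big(U_{p_J}x-\sum_{j\in J}\alpha_jp_j\Big)\Big\},$$ $$h'(x)=\max\Big\{\Lambda_{V(q_{I'})}\Big(-U_{q_{I'}}x-\sum_{i\in I'}\beta_iq_i\Big),\ \Lambda_{V(q_{J'})}\Big(U_{q_{J'}}x-\sum_{j\in J'}\beta_jq_j\Big)\Big\},$$ where a term whose index set is empty is omitted. Then: (i) $h$ and $h'$ are in the same part if and only if $p_I=q_{I'}$ and $p_J=q_{J'}$. (ii) If $h$ and $h'$ are in the same part, then $a=\sum_{i\in I}\alpha_ip_i+\sum_{j\in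 J}\alpha_jp_j$ and $b=\sum_{i\in I'}\beta_iq_i+\sum_{j\in J'}\beta_jq_j$ lie in $V(p_I,p_J)$ and $\delta(h,h')=\|a-b\|_{\rm var}$. (iii) With $p_{IJ}=p_I+p_J$, the part $(\mathcal P_h,\delta)$ is isometric to $(V(p_I,p_J)/\mathbb Rp_{IJ},\|\cdot\|_{\rm var})$: there is a bijection $\rho$ from $\mathcal P_h$ onto $V(p_I,p_J)/\mathbb Rp_{IJ}$ such that $\delta(g,g')=\|x-y\|_{\rm var}$ for all $g,g'\in\mathcal P_h$ and all representatives $x\in\rho(g)$, $y\in\rho(g')$. -/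

import Mathlib

open Topology Filter

universe u

/-! ## Horofunctions, Busemann points and the detour distance

A metric space is given here by a set `M` with its distance function `d : M → M → ℝ`; the functions
`M → ℝ` carry the topology of pointwise convergence. -/

/-- The internal metric functional `h_y(z) = d(z,y) - d(b,y)` with basepoint `b`. -/
def internalFunctional {M : Type u} (d : M → M → ℝ) (b y : M) : M → ℝ :=
  fun z => d z y - d b y

/-- The horofunction compactification: the closure of the set of all `h_y` in `ℝ^M`. -/
def horoCompactification {M : Type u} (d : M → M → ℝ) (b : M) : Set (M → ℝ) :=
  closure (Set.range (internalFunctional d b))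

/-- The horofunction boundary; its elements are the horofunctions. -/
def horoBoundary {M : Type u} (d : M → M → ℝ) (b : M) : Set (M → ℝ) :=
  horoCompactification d b \ Set.range (internalFunctional d b)

/-- Almost geodesic nets. -/
def IsAlmostGeodesic {M : Type u} (d : M → M → ℝ) {A : Type u} [Preorder A] (x : A → M) : Prop :=
  ∃ w : M, ∀ ε : ℝ, 0 < ε → ∃ β : A, ∀ α α' : A, β ≤ α' → α' ≤ α →
    d (x α) (x α') + d (x α') w - d (x α) w < ε

/-- The set of Busemann points: the horofunctions that are limits of `h_{x^α}` along some almost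
geodesic net `(x^α)`. -/
def busemannPoints {M : Type u} (d : M → M → ℝ) (b : M) : Set (M → ℝ) :=
  {h | h ∈ horoBoundary d b ∧
    ∃ (A : Type u) (_ : Preorder A) (_ : IsDirected A (· ≤ ·)) (_ : Nonempty A) (x : A → M),
      IsAlmostGeodesic d x ∧
      ∀ z : M, Tendsto (fun α => d z (x α) - d b (x α)) atTop (𝓝 (h z))}

/-- The detour cost
`H(h,h') = sup_W inf {d(b,x) + h'(x) : h_x ∈ W}`, where `W` runs through the neighbourhoods of `h`
in the horofunction compactification. -/
noncomputable def detourCost {M : Type u} (d : M → M → ℝ) (b : M) (h h' : M → ℝ) : EReal :=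
  ⨆ W ∈ 𝓝[horoCompactification d b] h,
    ⨅ (x : M) (_ : internalFunctional d b x ∈ W), ((d b x + h' x : ℝ) : EReal)

/-- The detour distance `δ(h,h') = H(h,h') + H(h',h)`. -/
noncomputable def detourDist {M : Type u} (d : M → M → ℝ) (b : M) (h h' : M → ℝ) : EReal :=
  detourCost d b h h' + detourCost d b h' h

/-- The parts are the classes of Busemann points at finite detour distance from each other. -/
def SamePart {M : Type u} (d : M → M → ℝ) (b : M) (h h' : M → ℝ) : Prop :=
  h ∈ busemannPoints d b ∧ h' ∈ busemannPoints d b ∧ detourDist d b h h' < ⊤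

/-- The part of `h`. -/
def partOf {M : Type u} (d : M → M → ℝ) (b : M) (h : M → ℝ) : Set (M → ℝ) :=
  {h' | SamePart d b h h'}

/-! ## Euclidean Jordan algebras -/

/-- A real Jordan algebra is Euclidean if it has an inner product `B` for which every
multiplication operator `L_x y = x • y` is symmetric. -/
class IsEuclideanJordan (V : Type u) [NonAssocCommRing V] [Module ℝ V] : Prop where
  exists_inner : ∃ B : V →ₗ[ℝ] V →ₗ[ℝ] ℝ,
    (∀ x y, B x y = B y x) ∧ (∀ x, x ≠ 0 → 0 < B x x) ∧ ∀ x y z, B (x * y) z = B y (x * z)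

section Jordan

variable {V : Type u} [NonAssocCommRing V] [Module ℝ V]

/-- A primitive idempotent: a nonzero idempotent that is not a sum of two nonzero idempotents. -/
def IsPrimitiveIdem (p : V) : Prop :=
  p * p = p ∧ p ≠ 0 ∧ ∀ q q' : V, q * q = q → q' * q' = q' → p = q + q' → q = 0 ∨ q' = 0

/-- A Jordan frame `p_1, …, p_r`: mutually orthogonal primitive idempotents whose sum is the
unit. -/
def IsJordanFrame {r : ℕ} (p : Fin r → V) : Prop :=
  (∀ i, IsPrimitiveIdem (p i)) ∧ (∀ i j, i ≠ j → p i * p j = 0) ∧ ∑ i, p i = 1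

/-- The cone of squares `{y² : y ∈ W}` of a subalgebra `W`. -/
def squareCone (W : Submodule ℝ V) : Set V :=
  {z | ∃ y ∈ W, z = y * y}

/-- The order-unit norm (spectral norm) of `V`, for the cone of squares and the unit `1`:
`‖x‖_u = inf {t ≥ 0 : -t 1 ≤ x ≤ t 1}`. -/
noncomputable def orderUnitNorm (x : V) : ℝ :=
  sInf {t : ℝ | 0 ≤ t ∧ t • (1 : V) + x ∈ squareCone (⊤ : Submodule ℝ V) ∧
    t • (1 : V) - x ∈ squareCone (⊤ : Submodule ℝ V)}

/-- The distance of the spectral norm. -/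
noncomputable def spectralDist (x y : V) : ℝ := orderUnitNorm (x - y)

/-- The maximal eigenvalue `Λ_W(z) = inf {t : z ≤ t e}` of an element `z` of a subalgebra `W` with
unit `e`; the order is that of the cone of squares of `W`. -/
noncomputable def maxEigen (W : Submodule ℝ V) (e z : V) : ℝ :=
  sInf {t : ℝ | t • e - z ∈ squareCone W}

/-- The variation norm `Λ_W(z) + Λ_W(-z)` on a subalgebra `W` with unit `e`. -/
noncomputable def varNorm (W : Submodule ℝ V) (e z : V) : ℝ :=
  maxEigen W e z + maxEigen W e (-z)

variable [SMulCommClass ℝ V V]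

/-- The quadratic representation `U_x y = 2 x(xy) - x² y`. -/
def quadRep (x : V) : V →ₗ[ℝ] V :=
  (2 : ℝ) • (LinearMap.mulLeft ℝ x ∘ₗ LinearMap.mulLeft ℝ x) - LinearMap.mulLeft ℝ (x * x)

/-- `V(p) = U_p(V)` for an idempotent `p`. -/
def peirceOne (p : V) : Submodule ℝ V := LinearMap.range (quadRep p)

/-- `V(p,q) = V(p) + V(q)` for orthogonal idempotents `p` and `q`; its unit is `p + q`. -/
def peirceSum (p q : V) : Submodule ℝ V := peirceOne p ⊔ peirceOne q

/-- `V(p,q)/ℝ(p+q)`. -/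
abbrev peirceQuotient (p q : V) : Type u :=
  peirceSum p q ⧸ (Submodule.span ℝ {p + q}).submoduleOf (peirceSum p q)

/-- The function
`x ↦ max {Λ_{V(p_I)}(-U_{p_I} x - ∑_{i ∈ I} α_i p_i), Λ_{V(p_J)}(U_{p_J} x - ∑_{j ∈ J} α_j p_j)}`,
where `p_I = ∑_{i ∈ I} p_i`; if `I` or `J` is empty, the corresponding term is omitted. -/
noncomputable def horoFun {r : ℕ} (p : Fin r → V) (I J : Finset (Fin r)) (α : Fin r → ℝ)
    (x : V) : ℝ :=
  let pI := ∑ i ∈ I, p i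
  let pJ := ∑ j ∈ J, p j
  let termI := maxEigen (peirceOne pI) pI (-(quadRep pI x) - ∑ i ∈ I, α i • p i)
  let termJ := maxEigen (peirceOne pJ) pJ (quadRep pJ x - ∑ j ∈ J, α j • p j)
  if I = ∅ then termJ else if J = ∅ then termI else max termI termJ

end Jordan

set_option linter.unusedSectionVars false

/-! ## Symmetric operators -/

/-! Everything is reduced to positivity. By the spectral theorem (`exists_spectral`) the cone of
squares consists of the x whose operator L_x is positive semidefinite (`isPos_iff`); it is closed,
convex and preserved by U_p. With P = p_I, Q = p_J and Λ the maximal eigenvalue relative to P + Q,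
the given functions are x ↦ Λ(U_Q x − U_P x − a), where a ∈ V(P,Q) has least eigenvalue 0, that is
Λ(−a) = 0 (`horoFun_eq_pairFun`, `lam_neg_frame`). The frames play no further role.

The inequality h_z(x) ≤ t says that t·1 + x + (‖z‖·1 − z) and t·1 − x + (‖z‖·1 + z) are positive. If
‖z‖·1 − z converges on a corner P and tends to infinity on the complementary corner, the first
condition becomes positivity of its compression by U_P, up to an arbitrarily small increase of t;
this rests on `exists_isPos_add_smul_one_sub`. The second behaves likewise with Q. Hence the
functions above are the limits of h_z along the rays t(P − Q) − (U_P a − U_Q a), which are almost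
geodesic (`tendsto_ray`, `pairFun_mem_busemannPoints`).

Along its ray the function attached to a equals −t, and the one attached to b equals −t + Λ(a − b).
As H(h,h') ≥ h' − h pointwise for 1-Lipschitz h', the ray gives both bounds for H = Λ(a − b)
(`detourCost_pairFun`), and symmetrizing gives the variation norm. For different pairs, finiteness
of H(h,h') bounds h' − h above; the growth rate along the ray of h then forces P' ≤ P and Q' ≤ Q,
and the converse cost gives equality (`eq_of_detourDist_lt_top`).

For the isometry no other horofunction may occur in the part. A compactness argument on spectral
decompositions shows that every horofunction has the form above (`exists_eq_pairFun`), so the part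
of h is parametrized by V(P,Q) modulo the shifts by P + Q that normalize the least eigenvalue to 0.
-/

/-- `B` is an inner product for which all multiplication operators are symmetric. -/
structure IsAssocInner {V : Type u} [NonAssocCommRing V] [Module ℝ V]
    (B : V →ₗ[ℝ] V →ₗ[ℝ] ℝ) : Prop where
  symm : ∀ x y, B x y = B y x
  pos : ∀ x, x ≠ 0 → 0 < B x x
  assoc : ∀ x y z, B (x * y) z = B y (x * z)

-- The set of eigenvalues is padded to exactly dim V numbers, so that the spectral decompositions of
-- all elements share one index type and can be passed to limits index by index.
open Polynomial in
theorem exists_finset_prod_X_sub_C_aeval_eq_zero {V : Type u} [AddCommGroup V] [Module ℝ V]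
    [FiniteDimensional ℝ V] (B : V →ₗ[ℝ] V →ₗ[ℝ] ℝ) (hsymm : ∀ x y, B x y = B y x)
    (hpos : ∀ x, x ≠ 0 → 0 < B x x) (T : Module.End ℝ V) (hT : ∀ x y, B (T x) y = B x (T y)) :
    ∃ s : Finset ℝ, s.card = Module.finrank ℝ V ∧ aeval T (∏ l ∈ s, (X - C l)) = 0 := by
  classical
  let core : InnerProductSpace.Core ℝ V :=
    { inner := fun x y => B x y
      conj_inner_symm := fun x y => by simpa using hsymm y x
      re_inner_nonneg := fun x => by
        by_cases hx : x = 0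
        · simp [hx]
        · simpa using (hpos x hx).le
      add_left := fun x y z => by simp
      smul_left := fun x y r => by simp
      definite := fun x hx => by
        by_contra h
        exact (hpos x h).ne' hx }
  let _ : NormedAddCommGroup V := core.toNormedAddCommGroup
  let _ : InnerProductSpace ℝ V := InnerProductSpace.ofCore core.toCore
  have hsym : LinearMap.IsSymmetric T := hT
  let b := hsym.eigenvectorBasis rfl
  let s₀ : Finset ℝ := Finset.univ.image (hsym.eigenvalues rfl)
  have hcard : s₀.card ≤ Module.finrank ℝ V := by
    simpa using Finset.card_image_le (s := Finset.univ) (f := hsym.eigenvalues rfl)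
  obtain ⟨s, hs, hsc⟩ := Infinite.exists_superset_card_eq s₀ _ hcard
  refine ⟨s, hsc, b.toBasis.ext fun i => ?_⟩
  have hi : hsym.eigenvalues rfl i ∈ s := hs (Finset.mem_image_of_mem _ (Finset.mem_univ i))
  rw [← Finset.prod_erase_mul _ _ hi, map_mul]
  have : T (b i) = hsym.eigenvalues rfl i • b i := hsym.apply_eigenvectorBasis rfl i
  simp [this]

section Algebra

variable {V : Type u} [NonAssocCommRing V] [Module ℝ V]

/-! ## Jordan identities -/

section Identities

variable [IsCommJordan V]

theorem jordan_linearized (a b c d : V) :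
    a * ((b * c) * d) + b * ((c * a) * d) + c * ((a * b) * d) =
      (b * c) * (a * d) + (c * a) * (b * d) + (a * b) * (c * d) := by
  have h := DFunLike.congr_fun (two_nsmul_lie_lmul_lmul_add_add_eq_zero a b c) d
  have h2 : (2 : ℕ) • (a * ((b * c) * d) - (b * c) * (a * d) + (b * ((c * a) * d)
      - (c * a) * (b * d)) + (c * ((a * b) * d) - (a * b) * (c * d))) = 0 := h
  have h3 : (2 : ℝ) • (a * ((b * c) * d) - (b * c) * (a * d) + (b * ((c * a) * d)
      - (c * a) * (b * d)) + (c * ((a * b) * d) - (a * b) * (c * d))) = 0 := by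
    rw [two_smul]; rwa [two_nsmul] at h2
  have h4 := (smul_eq_zero.1 h3).resolve_left two_ne_zero
  rw [← sub_eq_zero, ← h4]
  abel

/-- Compare the linearized identity with its copy in which a and d are exchanged. This expresses
L_{(bc)a} through multiplications by shorter products, which is the recursion for powers. -/
theorem jordan_mul_mul_mul (a b c d : V) :
    ((b * c) * a) * d = a * ((b * c) * d) + b * ((c * a) * d) + c * ((a * b) * d)
      - b * ((c * d) * a) - c * ((d * b) * a) := by
  have h1 := jordan_linearized a b c d
  have h2 := jordan_linearized d b c a
  rw [h1, mul_comm _ d, eq_sub_iff_add_eq, eq_sub_iff_add_eq, add_right_comm, h2, mul_comm d a,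
    mul_comm (c * d), mul_comm (d * b), mul_comm b a, mul_comm d b]
  abel

/-- The multiplication by an idempotent commutes with the multiplication by an element of its
Peirce-one space. -/
theorem idem_mul_mul_comm {e x : V} (he : e * e = e) (hx : e * x = x) (d : V) :
    e * (x * d) = x * (e * d) := by
  have h := jordan_linearized e e x d
  rw [mul_comm x e, hx, he] at h
  have : e * (x * d) - x * (e * d) = (e * (x * d) + e * (x * d) + x * (e * d)) -
    (x * (e * d) + x * (e * d) + e * (x * d)) := by abel
  rw [← sub_eq_zero, this, h, sub_self]

theorem idem_mul_mul_of_mem {e x y : V} (he : e * e = e) (hx : e * x = x) (hy : e * y = y) :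
    e * (x * y) = x * y := by
  rw [idem_mul_mul_comm he hx, hy]

end Identities

/-! ### Power associativity and the spectral theorem in a corner -/

variable [SMulCommClass ℝ V V]

theorem mulLeft_apply' (x y : V) : LinearMap.mulLeft ℝ x y = x * y := rfl

variable [IsCommJordan V]

theorem idem_mul_pow {e x : V} (he : e * e = e) (hx : e * x = x) (n : ℕ) :
    e * ((LinearMap.mulLeft ℝ x ^ n) e) = (LinearMap.mulLeft ℝ x ^ n) e := by
  induction n with
  | zero => simpa using he
  | succ n ih => rw [pow_succ']; exact idem_mul_mul_of_mem he hx ih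

/-- Powers are taken in the corner with unit e, so the zeroth is e. Both commutations are carried
together because the recursion for the (n+2)-nd power involves L_x and L_{x²} besides the two
preceding powers. -/
theorem commute_mulLeft_pow {e x : V} (he : e * e = e) (hx : e * x = x) (n : ℕ) :
    Commute (LinearMap.mulLeft ℝ ((LinearMap.mulLeft ℝ x ^ n) e)) (LinearMap.mulLeft ℝ x) ∧
    Commute (LinearMap.mulLeft ℝ ((LinearMap.mulLeft ℝ x ^ n) e))
      (LinearMap.mulLeft ℝ (x * x)) := by
  induction n using Nat.twoStepInduction with
  | zero =>
    constructor
    · ext d; exact idem_mul_mul_comm he hx d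
    · ext d; exact idem_mul_mul_comm he (idem_mul_mul_of_mem he hx hx) d
  | one =>
    have : (LinearMap.mulLeft ℝ x ^ 1) e = x := by simp [mul_comm x e, hx]
    rw [this]
    refine ⟨Commute.refl _, ?_⟩
    ext d; exact (IsJordan.lmul_lmul_comm_lmul x d).symm
  | more n ih1 ih2 =>
    set y := (LinearMap.mulLeft ℝ x ^ n) e with hy
    have hy1 : (LinearMap.mulLeft ℝ x ^ (n + 1)) e = x * y := by rw [pow_succ']; rfl
    have hy2 : (LinearMap.mulLeft ℝ x ^ (n + 2)) e = (x * y) * x := by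
      rw [pow_succ', mul_comm _ x, ← hy1]; rfl
    rw [hy1] at ih2
    have key : LinearMap.mulLeft ℝ ((x * y) * x) =
        LinearMap.mulLeft ℝ x * LinearMap.mulLeft ℝ (x * y) +
        LinearMap.mulLeft ℝ x * LinearMap.mulLeft ℝ (x * y) +
        LinearMap.mulLeft ℝ y * LinearMap.mulLeft ℝ (x * x) -
        LinearMap.mulLeft ℝ x * (LinearMap.mulLeft ℝ x * LinearMap.mulLeft ℝ y) -
        LinearMap.mulLeft ℝ y * (LinearMap.mulLeft ℝ x * LinearMap.mulLeft ℝ x) := by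
      ext d
      have := jordan_mul_mul_mul x x y d
      rw [mul_comm y x, mul_comm (y * d) x, mul_comm (d * x) x, mul_comm d x] at this
      exact this
    have hxx : Commute (LinearMap.mulLeft ℝ x) (LinearMap.mulLeft ℝ (x * x)) := by
      ext d; exact (IsJordan.lmul_lmul_comm_lmul x d).symm
    have hx1 : Commute (LinearMap.mulLeft ℝ x) (LinearMap.mulLeft ℝ x) := Commute.refl _
    have hx2 : Commute (LinearMap.mulLeft ℝ (x * x)) (LinearMap.mulLeft ℝ (x * x)) :=
      Commute.refl _
    rw [hy2, key]
    constructor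
    · exact ((((hx1.mul_left ih2.1).add_left (hx1.mul_left ih2.1)).add_left
        (ih1.1.mul_left hxx.symm)).sub_left (hx1.mul_left (hx1.mul_left ih1.1))).sub_left
        (ih1.1.mul_left (hx1.mul_left hx1))
    · exact ((((hxx.mul_left ih2.2).add_left (hxx.mul_left ih2.2)).add_left
        (ih1.2.mul_left hx2)).sub_left (hxx.mul_left (hxx.mul_left ih1.2))).sub_left
        (ih1.2.mul_left (hxx.mul_left hxx))

/-- Power associativity. -/
theorem pow_mul_pow {e x : V} (he : e * e = e) (hx : e * x = x) (m n : ℕ) :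
    (LinearMap.mulLeft ℝ x ^ m) e * (LinearMap.mulLeft ℝ x ^ n) e =
      (LinearMap.mulLeft ℝ x ^ (m + n)) e := by
  have h := ((commute_mulLeft_pow he hx m).1.pow_right n).eq
  have h2 := DFunLike.congr_fun h e
  rw [Module.End.mul_apply, Module.End.mul_apply, mulLeft_apply', mulLeft_apply',
    mul_comm _ e, idem_mul_pow he hx] at h2
  rw [h2, add_comm, pow_add, Module.End.mul_apply]

open Polynomial

theorem aeval_mul_aeval [IsScalarTower ℝ V V] {e x : V} (he : e * e = e) (hx : e * x = x)
    (f g : ℝ[X]) :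
    aeval (LinearMap.mulLeft ℝ x) f e * aeval (LinearMap.mulLeft ℝ x) g e =
      aeval (LinearMap.mulLeft ℝ x) (f * g) e := by
  induction f using Polynomial.induction_on' with
  | add f₁ f₂ h₁ h₂ => simp only [map_add, add_mul, LinearMap.add_apply, h₁, h₂]
  | monomial m a =>
    induction g using Polynomial.induction_on' with
    | add f₁ f₂ h₁ h₂ => simp only [map_add, mul_add, LinearMap.add_apply, h₁, h₂]
    | monomial n b =>
      rw [monomial_mul_monomial]
      simp only [aeval_monomial, Module.End.mul_apply, Module.algebraMap_end_apply, smul_mul_assoc,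
        mul_smul_comm, pow_mul_pow he hx, mul_smul]
      rw [smul_comm]

/-- The spectral theorem, relative to an idempotent `e` with `e * x = x`. -/
theorem exists_spectral [IsScalarTower ℝ V V] [FiniteDimensional ℝ V]
    {B : V →ₗ[ℝ] V →ₗ[ℝ] ℝ} (hB : IsAssocInner B) {e x : V} (he : e * e = e) (hx : e * x = x) :
    ∃ (c : Fin (Module.finrank ℝ V) → V) (l : Fin (Module.finrank ℝ V) → ℝ),
      (∀ i, c i * c i = c i) ∧ (∀ i j, i ≠ j → c i * c j = 0) ∧ (∀ i, e * c i = c i) ∧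
      ∑ i, c i = e ∧ x = ∑ i, l i • c i ∧ ∀ i, c i = 0 → l i = 0 := by
  classical
  set T : Module.End ℝ V := LinearMap.mulLeft ℝ x with hT
  obtain ⟨s, hs, hs0⟩ := exists_finset_prod_X_sub_C_aeval_eq_zero B hB.symm hB.pos T
    (fun y z => hB.assoc x y z)
  have hdvd : ∀ f : ℝ[X], (∀ l ∈ s, f.eval l = 0) → aeval T f = 0 := by
    intro f hf
    have : (∏ l ∈ s, (X - C l)) ∣ f :=
      Finset.prod_dvd_of_coprime
        (fun a _ b _ hab => pairwise_coprime_X_sub_C Function.injective_id hab)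
        (fun l hl => dvd_iff_isRoot.2 (hf l hl))
    obtain ⟨g, rfl⟩ := this
    rw [map_mul, hs0, zero_mul]
  have heq : ∀ f g : ℝ[X], (∀ l ∈ s, f.eval l = g.eval l) → aeval T f = aeval T g := by
    intro f g h
    rw [← sub_eq_zero, ← map_sub]
    exact hdvd _ fun l hl => by rw [eval_sub, h l hl, sub_self]
  have hbas : ∀ l ∈ s, ∀ m ∈ s, (Lagrange.basis s id l).eval m = if l = m then 1 else 0 := by
    intro l hl m hm
    split_ifs with h
    · subst h; exact Lagrange.eval_basis_self (v := id) (Set.injOn_id _) hl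
    · exact Lagrange.eval_basis_of_ne (v := id) h hm
  let d : ℝ → V := fun l => aeval T (Lagrange.basis s id l) e
  have hd1 : ∀ l ∈ s, d l * d l = d l := by
    intro l hl
    simp only [d, hT, aeval_mul_aeval he hx]
    rw [← hT, heq]
    intro m hm
    rw [eval_mul, hbas l hl m hm]; split_ifs <;> simp
  have hd2 : ∀ l ∈ s, ∀ m ∈ s, l ≠ m → d l * d m = 0 := by
    intro l hl m hm hlm
    simp only [d, hT, aeval_mul_aeval he hx]
    rw [← hT, hdvd]
    · rfl
    · intro k hk
      rw [eval_mul, hbas l hl k hk, hbas m hm k hk]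
      split_ifs with h1 h2 <;> simp
      exact hlm (h1.trans h2.symm)
  have hd3 : ∀ l, e * d l = d l := by
    intro l
    have h1 : aeval T (1 : ℝ[X]) e = e := by simp
    have h2 := aeval_mul_aeval he hx 1 (Lagrange.basis s id l)
    rw [← hT, h1, one_mul] at h2
    exact h2
  have hd4 : ∑ l ∈ s, d l = e := by
    have : aeval T (∑ l ∈ s, Lagrange.basis s id l) e = aeval T (1 : ℝ[X]) e := by
      rw [heq]
      intro m hm
      rw [eval_finsetSum, Finset.sum_congr rfl (fun l hl => hbas l hl m hm)]
      simp [hm]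
    rw [map_sum, LinearMap.sum_apply] at this
    simpa using this
  have hd5 : x = ∑ l ∈ s, l • d l := by
    have : aeval T (∑ l ∈ s, C l * Lagrange.basis s id l) e = aeval T (X : ℝ[X]) e := by
      rw [heq]
      intro m hm
      rw [eval_finsetSum]
      simp only [eval_mul, eval_C, eval_X]
      rw [Finset.sum_congr rfl (fun l hl => by rw [hbas l hl m hm])]
      simp [hm]
    have hxe : x * e = x := by rw [mul_comm, hx]
    rw [map_sum, LinearMap.sum_apply, aeval_X, hT, mulLeft_apply', hxe, ← hT] at this
    rw [← this]
    refine Finset.sum_congr rfl fun l _ => ?_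
    simp [d]
  let eq : Fin (Module.finrank ℝ V) ≃ s := (finCongr hs.symm).trans s.equivFin.symm
  -- A vanishing idempotent gets the coefficient 0, so that bounds on eigenvalues hold for every
  -- index.
  refine ⟨fun i => d (eq i), fun i => if d (eq i) = 0 then 0 else (eq i : ℝ),
    fun i => hd1 _ (eq i).2, fun i j hij => hd2 _ (eq i).2 _ (eq j).2 ?_, fun i => hd3 _, ?_, ?_,
    fun i hi => if_pos hi⟩
  · exact fun h => hij (eq.injective (Subtype.ext h))
  · rw [eq.sum_comp (fun l : s => d l), Finset.sum_coe_sort s d, hd4]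
  · calc x = ∑ l ∈ s, l • d l := hd5
      _ = ∑ l : s, (l : ℝ) • d l := (Finset.sum_coe_sort s fun l => l • d l).symm
      _ = ∑ i, (eq i : ℝ) • d (eq i) := (eq.sum_comp (fun l : s => (l : ℝ) • d l)).symm
      _ = _ := by
        refine Finset.sum_congr rfl fun i _ => ?_
        beta_reduce
        split_ifs with h
        · rw [h]; simp
        · rfl

end Algebra

section Cone

variable {V : Type u} [NonAssocCommRing V] [Module ℝ V]

/-! ## The cone of squares -/

/-- Membership in the cone of squares. -/
def IsPos (x : V) : Prop := x ∈ squareCone (⊤ : Submodule ℝ V)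

theorem isPos_mul_self (x : V) : IsPos (x * x) := ⟨x, trivial, rfl⟩

theorem IsPos.exists_eq {x : V} (h : IsPos x) : ∃ y, x = y * y := by
  obtain ⟨y, -, hy⟩ := h
  exact ⟨y, hy⟩

theorem isPos_of_idem {c : V} (h : c * c = c) : IsPos c := h ▸ isPos_mul_self c

theorem isPos_zero : IsPos (0 : V) := isPos_of_idem (mul_zero 0)

theorem one_sub_idem {c : V} (h : c * c = c) : (1 - c) * (1 - c) = 1 - c := by
  simp [mul_sub, sub_mul, h]

theorem sum_idem_mul [SMulCommClass ℝ V V] [IsScalarTower ℝ V V] {ι : Type*} {s : Finset ι}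
    {c : ι → V} (h1 : ∀ i, c i * c i = c i) (h2 : ∀ i j, i ≠ j → c i * c j = 0) (a b : ι → ℝ) :
    (∑ i ∈ s, a i • c i) * (∑ i ∈ s, b i • c i) = ∑ i ∈ s, (a i * b i) • c i := by
  rw [Finset.sum_mul]
  refine Finset.sum_congr rfl fun i hi => ?_
  rw [Finset.mul_sum, Finset.sum_eq_single i]
  · rw [smul_mul_assoc, mul_smul_comm, h1, mul_smul]
  · intro j _ hj
    rw [smul_mul_assoc, mul_smul_comm, h2 i j hj.symm, smul_zero, smul_zero]
  · exact fun h => absurd hi h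

theorem sum_idem_mul_sum_idem {ι : Type*} [DecidableEq ι] {s t : Finset ι}
    {c : ι → V} (h1 : ∀ i, c i * c i = c i) (h2 : ∀ i j, i ≠ j → c i * c j = 0) :
    (∑ i ∈ s, c i) * (∑ i ∈ t, c i) = ∑ i ∈ s ∩ t, c i := by
  rw [Finset.sum_mul, ← Finset.sum_filter_add_sum_filter_not s (· ∈ t), Finset.filter_mem_eq_inter]
  have h3 : ∀ i ∈ s ∩ t, c i * ∑ j ∈ t, c j = c i := by
    intro i hi
    rw [Finset.mul_sum, Finset.sum_eq_single i, h1]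
    · exact fun j _ hj => h2 i j hj.symm
    · exact fun h => absurd (Finset.mem_inter.1 hi).2 h
  have h4 : ∀ i ∈ s.filter (fun i => ¬ i ∈ t), c i * ∑ j ∈ t, c j = 0 := by
    intro i hi
    rw [Finset.mul_sum]
    refine Finset.sum_eq_zero fun j hj => h2 i j ?_
    rintro rfl
    exact (Finset.mem_filter.1 hi).2 hj
  rw [Finset.sum_congr rfl h3, Finset.sum_eq_zero h4, add_zero]

theorem isPos_sum_smul [SMulCommClass ℝ V V] [IsScalarTower ℝ V V] {ι : Type*} {s : Finset ι}
    {c : ι → V} (h1 : ∀ i, c i * c i = c i) (h2 : ∀ i j, i ≠ j → c i * c j = 0) {a : ι → ℝ}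
    (ha : ∀ i ∈ s, 0 ≤ a i) : IsPos (∑ i ∈ s, a i • c i) := by
  have := sum_idem_mul (s := s) h1 h2 (fun i => √(a i)) (fun i => √(a i))
  have h : ∑ i ∈ s, a i • c i = ∑ i ∈ s, (√(a i) * √(a i)) • c i :=
    Finset.sum_congr rfl fun i hi => by rw [Real.mul_self_sqrt (ha i hi)]
  rw [h, ← this]
  exact isPos_mul_self _

/-- The case a = b = c of the product formula: L_c(2L_c − 1)(L_c − 1) = 0, whence the Peirce
eigenvalues 0, 1/2, 1. -/
theorem idem_cubic [IsCommJordan V] {c : V} (hc : c * c = c) (d : V) :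
    c * (c * (c * d)) + c * (c * (c * d)) + c * d =
      c * (c * d) + c * (c * d) + c * (c * d) := by
  have h := jordan_mul_mul_mul c c c d
  simp only [hc] at h
  rw [mul_comm (c * d) c, mul_comm d c, mul_comm (c * d) c] at h
  nth_rw 3 [h]
  abel

variable {B : V →ₗ[ℝ] V →ₗ[ℝ] ℝ}

theorem IsAssocInner.nonneg (hB : IsAssocInner B) (x : V) : 0 ≤ B x x := by
  by_cases hx : x = 0
  · simp [hx]
  · exact (hB.pos x hx).le

theorem IsAssocInner.eq_zero (hB : IsAssocInner B) {x : V} (h : B x x = 0) : x = 0 := by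
  by_contra hx
  exact (hB.pos x hx).ne' h

theorem inner_sum_smul_idem (hB : IsAssocInner B) {ι : Type*} [Fintype ι] {c : ι → V}
    (h1 : ∀ i, c i * c i = c i) (h2 : ∀ i j, i ≠ j → c i * c j = 0) (l : ι → ℝ) (i : ι) :
    B (∑ j, l j • c j) (c i) = l i * B (c i) (c i) := by
  rw [map_sum, LinearMap.sum_apply, Finset.sum_eq_single i]
  · rw [map_smul, LinearMap.smul_apply, smul_eq_mul]
  · intro j _ hj
    rw [map_smul, LinearMap.smul_apply, ← h1 j, hB.assoc, h2 j i hj, map_zero, smul_zero]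
  · simp

/-- On the roots 0, 1/2, 1 one has λ = λ² + 4(λ − λ²)², so the form is |cy|² + 4|cy − c(cy)|². -/
theorem inner_mul_idem_nonneg [IsCommJordan V] (hB : IsAssocInner B) {c : V} (hc : c * c = c)
    (y : V) : 0 ≤ B (c * y) y := by
  have h := idem_cubic hc y
  have h1 := congrArg (fun v => B v y) h
  have h2 := congrArg (fun v => B v (c * y)) h
  simp only [map_add, LinearMap.add_apply] at h1 h2
  have e1 : B (c * (c * y)) y = B (c * y) (c * y) := hB.assoc _ _ _
  have e2 : B (c * (c * (c * y))) y = B (c * (c * y)) (c * y) := hB.assoc _ _ _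
  have e3 : B (c * (c * (c * y))) (c * y) = B (c * (c * y)) (c * (c * y)) := hB.assoc _ _ _
  have p1 := hB.nonneg (c * y - c * (c * y))
  have p2 := hB.nonneg (c * y)
  simp only [map_sub, LinearMap.sub_apply] at p1
  rw [hB.symm (c * y) (c * (c * y))] at p1
  linarith

/-- A square is a nonnegative combination of idempotents; conversely, testing on the spectral
idempotents of x shows its eigenvalues to be nonnegative. Convexity and closedness of the cone
follow from this form. -/
theorem isPos_iff [SMulCommClass ℝ V V] [IsScalarTower ℝ V V] [IsCommJordan V]
    [FiniteDimensional ℝ V] (hB : IsAssocInner B) {x : V} :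
    IsPos x ↔ ∀ y, 0 ≤ B (x * y) y := by
  constructor
  · intro hx y
    obtain ⟨z, rfl⟩ := hx.exists_eq
    obtain ⟨c, l, h1, h2, -, -, h5, -⟩ :=
        exists_spectral hB (e := 1) (x := z) (one_mul 1) (one_mul z)
    rw [h5, sum_idem_mul h1 h2, Finset.sum_mul, map_sum, LinearMap.sum_apply]
    refine Finset.sum_nonneg fun i _ => ?_
    rw [smul_mul_assoc, map_smul, LinearMap.smul_apply, smul_eq_mul]
    exact mul_nonneg (mul_self_nonneg _) (inner_mul_idem_nonneg hB (h1 i) y)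
  · intro h
    obtain ⟨c, l, h1, h2, -, -, h5, h6⟩ :=
        exists_spectral hB (e := 1) (x := x) (one_mul 1) (one_mul x)
    rw [h5]
    refine isPos_sum_smul h1 h2 fun i _ => ?_
    by_cases hc : c i = 0
    · exact (h6 i hc).ge
    have hxc : x * c i = l i • c i := by
      rw [h5, Finset.sum_mul, Finset.sum_eq_single i]
      · rw [smul_mul_assoc, h1]
      · intro j _ hj
        rw [smul_mul_assoc, h2 j i hj, smul_zero]
      · simp
    have := h (c i)
    rw [hxc, map_smul, LinearMap.smul_apply, smul_eq_mul] at this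
    exact nonneg_of_mul_nonneg_left this (hB.pos _ hc)

/-- An isotropic vector of a positive semidefinite form lies in its kernel: perturb z in the
direction xz. -/
theorem mul_eq_zero_of_inner_mul_eq_zero (hB : IsAssocInner B) {x z : V}
    (hx : ∀ y, 0 ≤ B (x * y) y) (hz : B (x * z) z = 0) : x * z = 0 := by
  refine hB.eq_zero ?_
  set b := B (x * z) (x * z) with hb
  set k := B (x * (x * z)) (x * z) with hk
  have hk0 : 0 ≤ k := hx _
  have hb' : B (x * (x * z)) z = b := hB.assoc _ _ _
  have hq : ∀ t : ℝ, 0 ≤ 2 * t * b + t ^ 2 * k := by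
    intro t
    have h := hx (z + t • (x * z))
    have hm : x * (t • (x * z)) = t • (x * (x * z)) := by
      have h1 : ∀ w, B (x * (t • (x * z)) - t • (x * (x * z))) w = 0 := by
        intro w
        rw [map_sub, LinearMap.sub_apply, hB.assoc]
        simp only [map_smul, LinearMap.smul_apply]
        rw [hB.assoc x (x * z) w, sub_self]
      exact sub_eq_zero.1 (hB.eq_zero (h1 _))
    rw [mul_add, hm] at h
    simp only [map_add, LinearMap.add_apply, map_smul, LinearMap.smul_apply, smul_eq_mul] at h
    rw [hz, ← hb, ← hk, hb'] at h
    linarith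
  by_contra hne
  have hbpos : 0 < b := lt_of_le_of_ne (hB.nonneg _) (Ne.symm hne)
  -- Nearly the minimizer −b/k of the quadratic; the shift avoids dividing by k = 0.
  have := hq (-b / (k + 1))
  have hk1 : 0 < k + 1 := by linarith
  have e : 2 * (-b / (k + 1)) * b + (-b / (k + 1)) ^ 2 * k = -(b ^ 2 * (k + 2)) / (k + 1) ^ 2 := by
    field_simp
    ring
  rw [e, le_div_iff₀ (by positivity)] at this
  have : 0 < b ^ 2 * (k + 2) := by positivity
  linarith

section Euclidean

variable [SMulCommClass ℝ V V] [IsScalarTower ℝ V V] [IsCommJordan V] [FiniteDimensional ℝ V]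

theorem IsPos.inner_nonneg (hB : IsAssocInner B) {v w : V} (hv : IsPos v) (hw : IsPos w) :
    0 ≤ B v w := by
  obtain ⟨y, rfl⟩ := hw.exists_eq
  have := (isPos_iff hB).1 hv y
  rwa [mul_comm, hB.assoc] at this

theorem IsPos.add' (hB : IsAssocInner B) {x y : V} (hx : IsPos x) (hy : IsPos y) :
    IsPos (x + y) := by
  rw [isPos_iff hB] at *
  intro z
  rw [add_mul, map_add, LinearMap.add_apply]
  exact add_nonneg (hx z) (hy z)

theorem IsPos.smul {x : V} (hx : IsPos x) {t : ℝ} (ht : 0 ≤ t) : IsPos (t • x) := by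
  obtain ⟨y, rfl⟩ := hx.exists_eq
  have : t • (y * y) = (√t • y) * (√t • y) := by
    rw [smul_mul_assoc, mul_smul_comm, smul_smul, Real.mul_self_sqrt ht]
  rw [this]
  exact isPos_mul_self _

theorem isPos_of_inner_nonneg (hB : IsAssocInner B) {x e : V} (he : e * e = e) (hx : e * x = x)
    (h : ∀ c, c * c = c → e * c = c → 0 ≤ B x c) : IsPos x := by
  obtain ⟨c, l, h1, h2, h3, -, h5, h6⟩ := exists_spectral hB he hx
  rw [h5]
  refine isPos_sum_smul h1 h2 fun i _ => ?_
  by_cases hc : c i = 0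
  · exact (h6 i hc).ge
  have hxc : B x (c i) = l i * B (c i) (c i) := by rw [h5, inner_sum_smul_idem hB h1 h2]
  have := h (c i) (h1 i) (h3 i)
  rw [hxc] at this
  exact nonneg_of_mul_nonneg_left this (hB.pos _ hc)

theorem IsPos.exists_eq_of_mem (hB : IsAssocInner B) {x e : V} (he : e * e = e) (hx : e * x = x)
    (h : IsPos x) : ∃ y, e * y = y ∧ x = y * y := by
  obtain ⟨c, l, h1, h2, h3, -, h5, h6⟩ := exists_spectral hB he hx
  have hl : ∀ i, 0 ≤ l i := by
    intro i
    by_cases hc : c i = 0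
    · exact (h6 i hc).ge
    have hxc : B x (c i) = l i * B (c i) (c i) := by rw [h5, inner_sum_smul_idem hB h1 h2]
    have := h.inner_nonneg hB (isPos_of_idem (h1 i))
    rw [hxc] at this
    exact nonneg_of_mul_nonneg_left this (hB.pos _ hc)
  refine ⟨∑ i, √(l i) • c i, ?_, ?_⟩
  · rw [Finset.mul_sum]
    exact Finset.sum_congr rfl fun i _ => by rw [mul_smul_comm, h3]
  · rw [sum_idem_mul h1 h2, h5]
    exact Finset.sum_congr rfl fun i _ => by rw [Real.mul_self_sqrt (hl i)]

/-- Expand w over idempotents: each weighted term of the pairing vanishes, and B(v, c) = B(vc, c) =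
0 puts c in the kernel of L_v. -/
theorem IsPos.mul_eq_zero (hB : IsAssocInner B) {v w : V} (hv : IsPos v) (hw : IsPos w)
    (h : B v w = 0) : v * w = 0 := by
  obtain ⟨y, rfl⟩ := hw.exists_eq
  obtain ⟨c, l, h1, h2, -, -, h5, -⟩ := exists_spectral hB (e := 1) (x := y) (one_mul 1) (one_mul y)
  have hy : y * y = ∑ i, (l i * l i) • c i := by rw [h5, sum_idem_mul h1 h2]
  rw [hy, map_sum] at h
  have h0 := (Finset.sum_eq_zero_iff_of_nonneg (fun i _ => by
    rw [map_smul, smul_eq_mul]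
    exact mul_nonneg (mul_self_nonneg _) (hv.inner_nonneg hB (isPos_of_idem (h1 i))))).1 h
  rw [hy, Finset.mul_sum]
  refine Finset.sum_eq_zero fun i hi => ?_
  have h3 := h0 i hi
  rw [map_smul, smul_eq_mul] at h3
  rcases _root_.mul_eq_zero.1 h3 with h4 | h4
  · rw [h4, zero_smul, mul_zero]
  · rw [mul_smul_comm, mul_eq_zero_of_inner_mul_eq_zero hB ((isPos_iff hB).1 hv), smul_zero]
    rwa [mul_comm, hB.assoc, h1]

theorem IsPos.eq_zero (hB : IsAssocInner B) {x : V} (h : IsPos x) (h' : IsPos (-x)) : x = 0 := by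
  refine hB.eq_zero (le_antisymm ?_ (hB.nonneg x))
  have := h'.inner_nonneg hB h
  rw [map_neg, LinearMap.neg_apply] at this
  linarith

theorem exists_isPos_smul_one_add (hB : IsAssocInner B) (x : V) :
    ∃ t : ℝ, 0 ≤ t ∧ IsPos (t • (1 : V) + x) ∧ IsPos (t • (1 : V) - x) := by
  obtain ⟨c, l, h1, h2, -, h4, h5, -⟩ :=
      exists_spectral hB (e := 1) (x := x) (one_mul 1) (one_mul x)
  have hle : ∀ i, |l i| ≤ ∑ j, |l j| := fun i =>
    Finset.single_le_sum (f := fun j => |l j|) (fun j _ => abs_nonneg _) (Finset.mem_univ i)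
  refine ⟨∑ i, |l i|, Finset.sum_nonneg fun i _ => abs_nonneg _, ?_, ?_⟩
  · rw [h5, ← h4, Finset.smul_sum, ← Finset.sum_add_distrib]
    simp only [← add_smul]
    exact isPos_sum_smul h1 h2 fun i _ => by
      have := hle i; have := neg_abs_le (l i); linarith
  · rw [h5, ← h4, Finset.smul_sum, ← Finset.sum_sub_distrib]
    simp only [← sub_smul]
    exact isPos_sum_smul h1 h2 fun i _ => by
      have := hle i; have := le_abs_self (l i); linarith

/-! ## Peirce spaces -/

theorem quadRep_apply (p x : V) : quadRep p x = (2 : ℝ) • (p * (p * x)) - p * p * x := rfl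

theorem idem_mul_quadRep {p : V} (hp : p * p = p) (x : V) :
    p * quadRep p x = quadRep p x := by
  rw [quadRep_apply, hp, mul_sub, mul_smul_comm]
  have h := idem_cubic hp x
  have : (2 : ℝ) • (p * (p * (p * x))) =
      (p * (p * (p * x)) + p * (p * (p * x)) + p * x) - p * x := by
    rw [two_smul]; abel
  rw [this, h, two_smul]
  abel

theorem quadRep_of_mem {p x : V} (hp : p * p = p) (hx : p * x = x) : quadRep p x = x := by
  rw [quadRep_apply, hp, hx, hx, two_smul, add_sub_cancel_right]

theorem quadRep_of_mul_eq_zero {p x : V} (hp : p * p = p) (hx : p * x = 0) :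
    quadRep p x = 0 := by
  rw [quadRep_apply, hp, hx, mul_zero, smul_zero, sub_zero]

theorem mem_peirceOne {p : V} (hp : p * p = p) {x : V} : x ∈ peirceOne p ↔ p * x = x := by
  constructor
  · rintro ⟨y, rfl⟩
    exact idem_mul_quadRep hp y
  · exact fun h => ⟨x, quadRep_of_mem hp h⟩

theorem quadRep_one {p : V} (hp : p * p = p) : quadRep p 1 = p := by
  rw [quadRep_apply, mul_one, mul_one, hp, two_smul, add_sub_cancel_right]

theorem inner_quadRep (hB : IsAssocInner B) {p : V} (x y : V) :
    B (quadRep p x) y = B x (quadRep p y) := by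
  simp only [quadRep_apply, map_sub, LinearMap.sub_apply, map_smul, LinearMap.smul_apply, hB.assoc]

/-- Self-adjointness of U_p moves the test onto idempotents c of the corner, where U_p c = c; the
fundamental formula is not needed. -/
theorem IsPos.quadRep (hB : IsAssocInner B) {p x : V} (hp : p * p = p) (hx : IsPos x) :
    IsPos (quadRep p x) := by
  refine isPos_of_inner_nonneg hB hp (idem_mul_quadRep hp x) fun c hc hpc => ?_
  rw [inner_quadRep hB, quadRep_of_mem hp hpc]
  exact hx.inner_nonneg hB (isPos_of_idem hc)

/-- Since p = U_p 1, the pairing B(p, x) equals B(1, U_p x) = 0. -/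
theorem IsPos.idem_mul_eq_zero (hB : IsAssocInner B) {p x : V} (hp : p * p = p) (hx : IsPos x)
    (h : _root_.quadRep p x = 0) : p * x = 0 := by
  refine (isPos_of_idem hp).mul_eq_zero hB hx ?_
  rw [← quadRep_one hp, inner_quadRep hB, h, map_zero]

/-- Commutation of L_p with L_x gives p(xy) = x(py) = 0, and the linearized identity gives xy =
p(xy). -/
theorem mul_eq_zero_of_peirce {p x y : V} (hp : p * p = p) (hx : p * x = x) (hy : p * y = 0) :
    x * y = 0 := by
  have h1 := idem_mul_mul_comm hp hx y
  have h2 := jordan_linearized p p y x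
  rw [hy, mul_zero] at h1
  rw [mul_comm y p, hy, hp, hx] at h2
  simp only [zero_mul, mul_zero, zero_add] at h2
  rw [mul_comm x y, h2, mul_comm y x, h1]

theorem idem_eq_of_mul_one_sub_eq_zero {p q : V} (h1 : p * (1 - q) = 0) (h2 : q * (1 - p) = 0) :
    p = q := by
  rw [mul_sub, mul_one, sub_eq_zero] at h1 h2
  rw [h1, mul_comm, ← h2]

theorem squareCone_peirceOne (hB : IsAssocInner B) {p x : V} (hp : p * p = p) (hx : p * x = x) :
    x ∈ squareCone (peirceOne p) ↔ IsPos x := by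
  constructor
  · rintro ⟨y, -, hy⟩
    exact ⟨y, trivial, hy⟩
  · intro h
    obtain ⟨y, hy1, hy2⟩ := h.exists_eq_of_mem hB hp hx
    exact ⟨y, (mem_peirceOne hp).2 hy1, hy2⟩

end Euclidean

end Cone

section Eigen

variable {V : Type u} [NonAssocCommRing V] [Module ℝ V]

/-! ## The maximal eigenvalue -/

/-- The maximal eigenvalue of `z` relative to an idempotent `e`, computed with the cone of squares
of the whole algebra. -/
noncomputable def lam (e z : V) : ℝ := sInf {t : ℝ | IsPos (t • e - z)}

variable {B : V →ₗ[ℝ] V →ₗ[ℝ] ℝ}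
variable [SMulCommClass ℝ V V] [IsScalarTower ℝ V V] [IsCommJordan V] [FiniteDimensional ℝ V]

theorem IsPos.smul_add_of_le (hB : IsAssocInner B) {e z : V} (he : e * e = e) {s t : ℝ}
    (hst : s ≤ t) (h : IsPos (s • e + z)) : IsPos (t • e + z) := by
  have := h.add' hB ((isPos_of_idem he).smul (sub_nonneg.2 hst))
  have e1 : s • e + z + (t - s) • e = t • e + z := by rw [sub_smul]; abel
  rwa [e1] at this

theorem isPos_of_forall_gt (hB : IsAssocInner B) {e z : V} {s : ℝ}
    (h : ∀ t, s < t → IsPos (t • e + z)) : IsPos (s • e + z) := by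
  rw [isPos_iff hB]
  intro y
  have h1 : ∀ t, s < t → 0 ≤ t * B (e * y) y + B (z * y) y := by
    intro t ht
    have := (isPos_iff hB).1 (h t ht) y
    simpa [add_mul, smul_mul_assoc] using this
  have h2 : Tendsto (fun t : ℝ => t * B (e * y) y + B (z * y) y) (𝓝[>] s)
      (𝓝 (s * B (e * y) y + B (z * y) y)) := by
    refine Tendsto.mono_left (Continuous.tendsto (by fun_prop) s) nhdsWithin_le_nhds
  have h3 := ge_of_tendsto h2 (eventually_nhdsWithin_of_forall fun t ht => h1 t ht)
  simpa [add_mul, smul_mul_assoc] using h3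

/-- The infimum is attained by closedness of the cone. From here on, identities and inequalities for
eigenvalues are obtained by comparing positivity conditions over all t. -/
theorem lam_le_iff (hB : IsAssocInner B) {e z : V} (he : e * e = e) (he0 : e ≠ 0) (hz : e * z = z)
    {t : ℝ} : lam e z ≤ t ↔ IsPos (t • e - z) := by
  -- Pairing t e − z ≥ 0 with e bounds t from below.
  have hbdd : BddBelow {t : ℝ | IsPos (t • e - z)} := by
    refine ⟨B z e / B e e, fun t ht => ?_⟩
    have h := IsPos.inner_nonneg hB ht (isPos_of_idem he)
    rw [map_sub, LinearMap.sub_apply, map_smul, LinearMap.smul_apply, smul_eq_mul] at h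
    rw [div_le_iff₀ (hB.pos e he0)]
    linarith
  have hne : {t : ℝ | IsPos (t • e - z)}.Nonempty := by
    obtain ⟨t, -, -, h⟩ := exists_isPos_smul_one_add hB z
    have := h.quadRep hB he
    rw [map_sub, map_smul, quadRep_one he, quadRep_of_mem he hz] at this
    exact ⟨t, this⟩
  constructor
  · intro h
    rw [sub_eq_add_neg]
    refine isPos_of_forall_gt hB fun s hs => ?_
    obtain ⟨r, hr, hrs⟩ := exists_lt_of_csInf_lt hne (h.trans_lt hs)
    rw [Set.mem_ofPred_eq, sub_eq_add_neg] at hr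
    exact hr.smul_add_of_le hB he hrs.le
  · exact fun h => csInf_le hbdd h

theorem isPos_lam (hB : IsAssocInner B) {e z : V} (he : e * e = e) (he0 : e ≠ 0)
    (hz : e * z = z) : IsPos (lam e z • e - z) :=
  (lam_le_iff hB he he0 hz).1 le_rfl

theorem lam_add_le (hB : IsAssocInner B) {e y z : V} (he : e * e = e) (he0 : e ≠ 0)
    (hy : e * y = y) (hz : e * z = z) : lam e (y + z) ≤ lam e y + lam e z := by
  rw [lam_le_iff hB he he0 (by rw [mul_add, hy, hz])]
  have := (isPos_lam hB he he0 hy).add' hB (isPos_lam hB he he0 hz)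
  rwa [sub_add_sub_comm, ← add_smul] at this

theorem lam_smul_add (hB : IsAssocInner B) {e z : V} (he : e * e = e) (he0 : e ≠ 0)
    (hz : e * z = z) (s : ℝ) : lam e (s • e + z) = s + lam e z := by
  refine eq_of_forall_ge_iff fun t => ?_
  rw [lam_le_iff hB he he0 (by rw [mul_add, mul_smul_comm, he, hz]), ← le_sub_iff_add_le',
    lam_le_iff hB he he0 hz, sub_smul, sub_add_eq_sub_sub]

theorem isPos_smul_idem_iff (hB : IsAssocInner B) {e : V} (he : e * e = e) (he0 : e ≠ 0)
    {t : ℝ} : IsPos (t • e) ↔ 0 ≤ t := by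
  constructor
  · intro h
    have h := IsPos.inner_nonneg hB h (isPos_of_idem he)
    rw [map_smul, LinearMap.smul_apply, smul_eq_mul] at h
    exact nonneg_of_mul_nonneg_left h (hB.pos e he0)
  · exact fun h => (isPos_of_idem he).smul h

theorem lam_zero (hB : IsAssocInner B) {e : V} (he : e * e = e) (he0 : e ≠ 0) :
    lam e 0 = 0 := by
  refine eq_of_forall_ge_iff fun t => ?_
  rw [lam_le_iff hB he he0 (mul_zero e), sub_zero, isPos_smul_idem_iff hB he he0]

theorem eq_zero_of_lam_nonpos (hB : IsAssocInner B) {e z : V} (he : e * e = e) (he0 : e ≠ 0)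
    (hz : e * z = z) (h1 : lam e z ≤ 0) (h2 : lam e (-z) ≤ 0) : z = 0 := by
  rw [lam_le_iff hB he he0 hz, zero_smul, zero_sub] at h1
  rw [lam_le_iff hB he he0 (by rw [mul_neg, hz]), zero_smul, zero_sub, neg_neg] at h2
  exact h2.eq_zero hB h1

theorem maxEigen_peirceOne (hB : IsAssocInner B) {p z : V} (hp : p * p = p) (hz : p * z = z) :
    maxEigen (peirceOne p) p z = lam p z := by
  unfold maxEigen lam
  congr 1
  ext t
  exact squareCone_peirceOne hB hp (by rw [mul_sub, mul_smul_comm, hp, hz])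

/-! ## The spectral norm -/

section Norm

variable [Nontrivial V]

theorem orderUnitNorm_le_iff (hB : IsAssocInner B) {x : V} {t : ℝ} :
    orderUnitNorm x ≤ t ↔ IsPos (t • (1 : V) + x) ∧ IsPos (t • (1 : V) - x) := by
  have h1 : (1 : V) * 1 = 1 := one_mul 1
  have hset : {t : ℝ | 0 ≤ t ∧ t • (1 : V) + x ∈ squareCone (⊤ : Submodule ℝ V) ∧
      t • (1 : V) - x ∈ squareCone (⊤ : Submodule ℝ V)} = Set.Ici (max (lam 1 (-x)) (lam 1 x)) := by
    ext t
    have e1 := lam_le_iff hB h1 one_ne_zero (one_mul (-x)) (t := t)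
    have e2 := lam_le_iff hB h1 one_ne_zero (one_mul x) (t := t)
    rw [sub_neg_eq_add] at e1
    rw [Set.mem_Ici, max_le_iff, e1, e2]
    refine ⟨fun h => h.2, fun h => ⟨?_, h⟩⟩
    have h3 := h.1.add' hB h.2
    rw [add_add_sub_cancel, ← add_smul, isPos_smul_idem_iff hB h1 one_ne_zero] at h3
    linarith
  have e1 := lam_le_iff hB h1 one_ne_zero (one_mul (-x)) (t := t)
  have e2 := lam_le_iff hB h1 one_ne_zero (one_mul x) (t := t)
  rw [sub_neg_eq_add] at e1
  unfold orderUnitNorm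
  rw [hset, csInf_Ici, max_le_iff, e1, e2]

theorem orderUnitNorm_spec (hB : IsAssocInner B) (x : V) :
    IsPos (orderUnitNorm x • (1 : V) + x) ∧ IsPos (orderUnitNorm x • (1 : V) - x) :=
  (orderUnitNorm_le_iff hB).1 le_rfl

theorem orderUnitNorm_neg (hB : IsAssocInner B) (x : V) : orderUnitNorm (-x) = orderUnitNorm x := by
  refine eq_of_forall_ge_iff fun t => ?_
  rw [orderUnitNorm_le_iff hB, orderUnitNorm_le_iff hB, and_comm, sub_neg_eq_add, sub_eq_add_neg]

theorem orderUnitNorm_add_le (hB : IsAssocInner B) (x y : V) :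
    orderUnitNorm (x + y) ≤ orderUnitNorm x + orderUnitNorm y := by
  rw [orderUnitNorm_le_iff hB]
  obtain ⟨hx1, hx2⟩ := orderUnitNorm_spec hB x
  obtain ⟨hy1, hy2⟩ := orderUnitNorm_spec hB y
  constructor
  · have := hx1.add' hB hy1
    rwa [add_add_add_comm, ← add_smul] at this
  · have := hx2.add' hB hy2
    rwa [sub_add_sub_comm, ← add_smul] at this

theorem orderUnitNorm_nonneg (x : V) : 0 ≤ orderUnitNorm x :=
  Real.sInf_nonneg fun _ ht => ht.1

end Norm

/-! ## Pairs of orthogonal idempotents -/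

/-- `P` and `Q` are orthogonal idempotents, not both zero. -/
structure IsOrthPair (P Q : V) : Prop where
  idem_left : P * P = P
  idem_right : Q * Q = Q
  orth : P * Q = 0
  ne_zero : P + Q ≠ 0

namespace IsOrthPair

variable {P Q : V}

theorem symm (h : IsOrthPair P Q) : IsOrthPair Q P :=
  ⟨h.idem_right, h.idem_left, by rw [mul_comm, h.orth], by rw [add_comm]; exact h.ne_zero⟩

theorem idem_add (h : IsOrthPair P Q) : (P + Q) * (P + Q) = P + Q := by
  rw [mul_add, add_mul, add_mul, h.idem_left, h.idem_right, h.orth, mul_comm Q P, h.orth, add_zero,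
    zero_add]

theorem left_mul_of_mem_right (h : IsOrthPair P Q) {y : V} (hy : Q * y = y) : P * y = 0 := by
  rw [mul_comm]
  exact mul_eq_zero_of_peirce h.idem_right hy h.symm.orth

theorem right_mul_of_mem_left (h : IsOrthPair P Q) {x : V} (hx : P * x = x) : Q * x = 0 :=
  h.symm.left_mul_of_mem_right hx

theorem add_mul_quadRep_left (h : IsOrthPair P Q)
    (x : V) : (P + Q) * quadRep P x = quadRep P x := by
  rw [add_mul, h.right_mul_of_mem_left (idem_mul_quadRep h.idem_left x),
    idem_mul_quadRep h.idem_left, add_zero]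

theorem add_mul_quadRep_right (h : IsOrthPair P Q)
    (x : V) : (P + Q) * quadRep Q x = quadRep Q x := by
  rw [add_comm, h.symm.add_mul_quadRep_left]

theorem quadRep_left_quadRep_right (h : IsOrthPair P Q) (x : V) : quadRep P (quadRep Q x) = 0 :=
  quadRep_of_mul_eq_zero h.idem_left (h.left_mul_of_mem_right (idem_mul_quadRep h.idem_right x))

theorem quadRep_right_quadRep_left (h : IsOrthPair P Q) (x : V) : quadRep Q (quadRep P x) = 0 :=
  h.symm.quadRep_left_quadRep_right x

theorem mem_peirceSum (h : IsOrthPair P Q)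
    {z : V} : z ∈ peirceSum P Q ↔ z = quadRep P z + quadRep Q z := by
  constructor
  · intro hz
    obtain ⟨x, hx, y, hy, rfl⟩ := Submodule.mem_sup.1 hz
    rw [mem_peirceOne h.idem_left] at hx
    rw [mem_peirceOne h.idem_right] at hy
    rw [map_add, map_add, quadRep_of_mem h.idem_left hx, quadRep_of_mem h.idem_right hy,
      quadRep_of_mul_eq_zero h.idem_left (h.left_mul_of_mem_right hy),
      quadRep_of_mul_eq_zero h.idem_right (h.right_mul_of_mem_left hx), add_zero, zero_add]
  · intro hz
    rw [hz]
    exact Submodule.add_mem_sup ⟨z, rfl⟩ ⟨z, rfl⟩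

theorem add_mul_of_mem (h : IsOrthPair P Q) {z : V} (hz : z ∈ peirceSum P Q) : (P + Q) * z = z := by
  rw [h.mem_peirceSum.1 hz, mul_add, h.add_mul_quadRep_left, h.add_mul_quadRep_right]

theorem left_mem (h : IsOrthPair P Q) : P ∈ peirceSum P Q :=
  Submodule.mem_sup_left ((mem_peirceOne h.idem_left).2 h.idem_left)

theorem right_mem (h : IsOrthPair P Q) : Q ∈ peirceSum P Q :=
  Submodule.mem_sup_right ((mem_peirceOne h.idem_right).2 h.idem_right)

theorem add_mem (h : IsOrthPair P Q)
    : P + Q ∈ peirceSum P Q := Submodule.add_mem _ h.left_mem h.right_mem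

theorem quadRep_left_mem (P Q x : V) : quadRep P x ∈ peirceSum P Q :=
  Submodule.mem_sup_left ⟨x, rfl⟩

theorem quadRep_right_mem (P Q x : V) : quadRep Q x ∈ peirceSum P Q :=
  Submodule.mem_sup_right ⟨x, rfl⟩

theorem isPos_iff_of_mem (h : IsOrthPair P Q)
    (hB : IsAssocInner B) {z : V} (hz : z ∈ peirceSum P Q) :
    IsPos z ↔ IsPos (quadRep P z) ∧ IsPos (quadRep Q z) := by
  refine ⟨fun hp => ⟨hp.quadRep hB h.idem_left, hp.quadRep hB h.idem_right⟩, fun hp => ?_⟩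
  rw [h.mem_peirceSum.1 hz]
  exact hp.1.add' hB hp.2

/-- Square roots can be taken in the two corners separately, because their product vanishes. -/
theorem mem_squareCone_peirceSum (h : IsOrthPair P Q)
    (hB : IsAssocInner B) {z : V} (hz : z ∈ peirceSum P Q) :
    z ∈ squareCone (peirceSum P Q) ↔ IsPos z := by
  constructor
  · rintro ⟨y, -, hy⟩
    exact ⟨y, trivial, hy⟩
  · intro hp
    rw [h.isPos_iff_of_mem hB hz] at hp
    obtain ⟨x, hx, hx'⟩ := hp.1.exists_eq_of_mem hB h.idem_left (idem_mul_quadRep h.idem_left z)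
    obtain ⟨y, hy, hy'⟩ := hp.2.exists_eq_of_mem hB h.idem_right (idem_mul_quadRep h.idem_right z)
    have hxy : x * y = 0 := mul_eq_zero_of_peirce h.idem_left hx (h.left_mul_of_mem_right hy)
    refine ⟨x + y, Submodule.add_mem_sup ((mem_peirceOne h.idem_left).2 hx)
      ((mem_peirceOne h.idem_right).2 hy), ?_⟩
    rw [mul_add, add_mul, add_mul, hxy, mul_comm y x, hxy, add_zero, zero_add, ← hx', ← hy']
    exact h.mem_peirceSum.1 hz

theorem maxEigen_peirceSum (h : IsOrthPair P Q)
    (hB : IsAssocInner B) {z : V} (hz : z ∈ peirceSum P Q) :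
    maxEigen (peirceSum P Q) (P + Q) z = lam (P + Q) z := by
  unfold maxEigen lam
  congr 1
  ext t
  exact h.mem_squareCone_peirceSum hB (Submodule.sub_mem _ (Submodule.smul_mem _ _ h.add_mem) hz)

theorem varNorm_peirceSum (h : IsOrthPair P Q)
    (hB : IsAssocInner B) {z : V} (hz : z ∈ peirceSum P Q) :
    varNorm (peirceSum P Q) (P + Q) z = lam (P + Q) z + lam (P + Q) (-z) := by
  unfold varNorm
  rw [h.maxEigen_peirceSum hB hz, h.maxEigen_peirceSum hB (Submodule.neg_mem _ hz)]

theorem lam_add_le (h : IsOrthPair P Q) (hB : IsAssocInner B) {y z : V} (hy : y ∈ peirceSum P Q)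
    (hz : z ∈ peirceSum P Q) : lam (P + Q) (y + z) ≤ lam (P + Q) y + lam (P + Q) z :=
  _root_.lam_add_le hB h.idem_add h.ne_zero (h.add_mul_of_mem hy) (h.add_mul_of_mem hz)

theorem lam_smul_add (h : IsOrthPair P Q)
    (hB : IsAssocInner B) {z : V} (hz : z ∈ peirceSum P Q) (s : ℝ) :
    lam (P + Q) (s • (P + Q) + z) = s + lam (P + Q) z :=
  _root_.lam_smul_add hB h.idem_add h.ne_zero (h.add_mul_of_mem hz) s

end IsOrthPair

/-- The function `x ↦ Λ_{V(P,Q)}(U_Q x - U_P x - a)`. -/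
noncomputable def pairFun (P Q a x : V) : ℝ := lam (P + Q) (quadRep Q x - quadRep P x - a)

namespace IsOrthPair

variable {P Q : V}

theorem pairFun_arg_mem {a : V} (ha : a ∈ peirceSum P Q) (x : V) :
    quadRep Q x - quadRep P x - a ∈ peirceSum P Q :=
  Submodule.sub_mem _ (Submodule.sub_mem _ (quadRep_right_mem P Q x) (quadRep_left_mem P Q x)) ha

/-- Positivity in V(P,Q) is decided corner by corner. The condition of a zero corner is void, so P =
0 and Q = 0 need no separate treatment. -/
theorem pairFun_le_iff (h : IsOrthPair P Q)
    (hB : IsAssocInner B) {a : V} (ha : a ∈ peirceSum P Q) {x : V} {t : ℝ} :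
    pairFun P Q a x ≤ t ↔ IsPos (t • P + quadRep P x + quadRep P a) ∧
      IsPos (t • Q - quadRep Q x + quadRep Q a) := by
  have hm := pairFun_arg_mem ha x
  unfold pairFun
  rw [lam_le_iff hB h.idem_add h.ne_zero (h.add_mul_of_mem hm), h.isPos_iff_of_mem hB
    (Submodule.sub_mem _ (Submodule.smul_mem _ _ h.add_mem) hm)]
  have h1 : quadRep P (t • (P + Q) - (quadRep Q x - quadRep P x - a)) =
      t • P + quadRep P x + quadRep P a := by
    simp only [map_sub, map_add, map_smul, h.quadRep_left_quadRep_right,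
      quadRep_of_mem h.idem_left h.idem_left, quadRep_of_mul_eq_zero h.idem_left h.orth,
      quadRep_of_mem h.idem_left (idem_mul_quadRep h.idem_left x)]
    rw [add_zero]; abel
  have h2 : quadRep Q (t • (P + Q) - (quadRep Q x - quadRep P x - a)) =
      t • Q - quadRep Q x + quadRep Q a := by
    simp only [map_sub, map_add, map_smul, h.quadRep_right_quadRep_left,
      quadRep_of_mem h.idem_right h.idem_right, quadRep_of_mul_eq_zero h.idem_right h.symm.orth,
      quadRep_of_mem h.idem_right (idem_mul_quadRep h.idem_right x)]
    rw [zero_add]; abel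
  rw [h1, h2]

end IsOrthPair

/-! ## Jordan frames -/

theorem isOrthPair_of_frame {r : ℕ} {p : Fin r → V} (hp : IsJordanFrame p) {I J : Finset (Fin r)}
    (hIJ : Disjoint I J) (hne : (I ∪ J).Nonempty) :
    IsOrthPair (∑ i ∈ I, p i) (∑ j ∈ J, p j) := by
  have h1 : ∀ i, p i * p i = p i := fun i => (hp.1 i).1
  refine ⟨?_, ?_, ?_, ?_⟩
  · rw [sum_idem_mul_sum_idem h1 hp.2.1, Finset.inter_self]
  · rw [sum_idem_mul_sum_idem h1 hp.2.1, Finset.inter_self]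
  · rw [sum_idem_mul_sum_idem h1 hp.2.1, Finset.disjoint_iff_inter_eq_empty.1 hIJ,
      Finset.sum_empty]
  · rw [← Finset.sum_union hIJ]
    intro h0
    obtain ⟨i, hi⟩ := hne
    have := sum_idem_mul_sum_idem h1 hp.2.1 (s := I ∪ J) (t := {i})
    rw [h0, zero_mul, Finset.inter_singleton_of_mem hi, Finset.sum_singleton] at this
    exact (hp.1 i).2.1 this.symm

theorem sum_idem_mul_sum_smul {ι : Type*} {s : Finset ι} {c : ι → V}
    (h1 : ∀ i, c i * c i = c i) (h2 : ∀ i j, i ≠ j → c i * c j = 0) (a : ι → ℝ) :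
    (∑ i ∈ s, c i) * (∑ i ∈ s, a i • c i) = ∑ i ∈ s, a i • c i := by
  simpa using sum_idem_mul (s := s) h1 h2 (fun _ => 1) a

theorem sum_smul_mem_peirceSum {r : ℕ} {p : Fin r → V} (hp : IsJordanFrame p)
    {I J : Finset (Fin r)} (hIJ : Disjoint I J) (hne : (I ∪ J).Nonempty) (α : Fin r → ℝ) :
    ∑ i ∈ I, α i • p i + ∑ j ∈ J, α j • p j ∈ peirceSum (∑ i ∈ I, p i) (∑ j ∈ J, p j) := by
  have hpair := isOrthPair_of_frame hp hIJ hne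
  have h1 : ∀ i, p i * p i = p i := fun i => (hp.1 i).1
  exact Submodule.add_mem_sup
    ((mem_peirceOne hpair.idem_left).2 (sum_idem_mul_sum_smul h1 hp.2.1 α))
    ((mem_peirceOne hpair.idem_right).2 (sum_idem_mul_sum_smul h1 hp.2.1 α))

/-- The maximum of two eigenvalues is at most t exactly when both corner conditions hold, and an
omitted term corresponds to a void condition. -/
theorem horoFun_eq_pairFun (hB : IsAssocInner B) {r : ℕ} {p : Fin r → V} (hp : IsJordanFrame p)
    {I J : Finset (Fin r)} (hIJ : Disjoint I J) (hne : (I ∪ J).Nonempty) (α : Fin r → ℝ) :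
    horoFun p I J α = pairFun (∑ i ∈ I, p i) (∑ j ∈ J, p j)
      (∑ i ∈ I, α i • p i + ∑ j ∈ J, α j • p j) := by
  have hpair := isOrthPair_of_frame hp hIJ hne
  have h1 : ∀ i, p i * p i = p i := fun i => (hp.1 i).1
  have hne0 : ∀ K : Finset (Fin r), K ≠ ∅ → ∑ i ∈ K, p i ≠ 0 := by
    intro K hK h0
    have := isOrthPair_of_frame hp (I := K) (J := ∅) (Finset.disjoint_empty_right K)
      (by rwa [Finset.union_empty, Finset.nonempty_iff_ne_empty])
    exact this.ne_zero (by rw [h0, Finset.sum_empty, add_zero])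
  have hmI := sum_idem_mul_sum_smul (s := I) h1 hp.2.1 α
  have hmJ := sum_idem_mul_sum_smul (s := J) h1 hp.2.1 α
  have hI0 : I = ∅ → ∑ i ∈ I, p i = 0 := by rintro rfl; simp
  have hJ0 : J = ∅ → ∑ i ∈ J, p i = 0 := by rintro rfl; simp
  unfold horoFun
  set P := ∑ i ∈ I, p i
  set Q := ∑ j ∈ J, p j
  set a := ∑ i ∈ I, α i • p i
  set b := ∑ j ∈ J, α j • p j
  have hab : a + b ∈ peirceSum P Q := sum_smul_mem_peirceSum hp hIJ hne α
  have hPab : quadRep P (a + b) = a := by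
    rw [map_add, quadRep_of_mem hpair.idem_left hmI, quadRep_of_mul_eq_zero hpair.idem_left
      (hpair.left_mul_of_mem_right hmJ), add_zero]
  have hQab : quadRep Q (a + b) = b := by
    rw [map_add, quadRep_of_mem hpair.idem_right hmJ, quadRep_of_mul_eq_zero hpair.idem_right
      (hpair.right_mul_of_mem_left hmI), zero_add]
  funext x
  refine eq_of_forall_ge_iff fun t => ?_
  have hxI : P * (-(quadRep P x) - a) = -(quadRep P x) - a := by
    rw [mul_sub, mul_neg, idem_mul_quadRep hpair.idem_left, hmI]
  have hxJ : Q * (quadRep Q x - b) = quadRep Q x - b := by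
    rw [mul_sub, idem_mul_quadRep hpair.idem_right, hmJ]
  have eI : P ≠ 0 → (maxEigen (peirceOne P) P (-(quadRep P x) - a) ≤ t ↔
      IsPos (t • P + quadRep P x + a)) := by
    intro h0
    rw [maxEigen_peirceOne hB hpair.idem_left hxI, lam_le_iff hB hpair.idem_left h0 hxI]
    rw [sub_sub_eq_add_sub, sub_neg_eq_add, add_right_comm]
  have eJ : Q ≠ 0 → (maxEigen (peirceOne Q) Q (quadRep Q x - b) ≤ t ↔
      IsPos (t • Q - quadRep Q x + b)) := by
    intro h0
    rw [maxEigen_peirceOne hB hpair.idem_right hxJ, lam_le_iff hB hpair.idem_right h0 hxJ]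
    rw [sub_sub_eq_add_sub, sub_add_eq_add_sub]
  have triv : ∀ R : V, R = 0 → ∀ y, IsPos (t • R + quadRep R x + quadRep R y) ∧
      IsPos (t • R - quadRep R x + quadRep R y) := by
    rintro R rfl y
    simp only [quadRep_apply, zero_mul, smul_zero, sub_self, add_zero]
    exact ⟨isPos_zero, isPos_zero⟩
  rw [hpair.pairFun_le_iff hB hab]
  have tP := triv P
  have tQ := triv Q
  dsimp only
  split_ifs with hI hJ
  · have hQ0 : Q ≠ 0 := hne0 J (by rintro rfl; subst hI; simp at hne)
    rw [eJ hQ0, hQab]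
    exact ⟨fun h => ⟨(tP (hI0 hI) _).1, h⟩, fun h => h.2⟩
  · rw [eI (hne0 I hI), hPab]
    exact ⟨fun h => ⟨h, (tQ (hJ0 hJ) _).2⟩, fun h => h.1⟩
  · rw [max_le_iff, eI (hne0 I hI), eJ (hne0 J hJ), hPab, hQab]

/-- The α_i are the eigenvalues of a in V(P,Q); pairing with a p_i for which α_i = 0 shows that the
bound 0 is sharp. -/
theorem lam_neg_frame (hB : IsAssocInner B) {r : ℕ} {p : Fin r → V} (hp : IsJordanFrame p)
    {I J : Finset (Fin r)} (hIJ : Disjoint I J) (hne : (I ∪ J).Nonempty) {α : Fin r → ℝ}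
    (hα : IsLeast (α '' (I ∪ J : Finset (Fin r))) 0) :
    lam (∑ i ∈ I, p i + ∑ j ∈ J, p j) (-(∑ i ∈ I, α i • p i + ∑ j ∈ J, α j • p j)) = 0 := by
  have hpair := isOrthPair_of_frame hp hIJ hne
  have h1 : ∀ i, p i * p i = p i := fun i => (hp.1 i).1
  have h0 := hpair.ne_zero
  have hi := hpair.idem_add
  rw [← Finset.sum_union hIJ] at *
  rw [← Finset.sum_union hIJ]
  have hm := sum_idem_mul_sum_smul (s := I ∪ J) h1 hp.2.1 α
  refine eq_of_forall_ge_iff fun t => ?_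
  rw [lam_le_iff hB hi h0 (by rw [mul_neg, hm]), sub_neg_eq_add, Finset.smul_sum,
    ← Finset.sum_add_distrib]
  simp only [← add_smul]
  constructor
  · intro h
    obtain ⟨i, hi, hi0⟩ := hα.1
    have := IsPos.inner_nonneg hB h (isPos_of_idem (h1 i))
    rw [map_sum, LinearMap.sum_apply, Finset.sum_eq_single i] at this
    · rw [map_smul, LinearMap.smul_apply, smul_eq_mul, hi0, add_zero] at this
      exact nonneg_of_mul_nonneg_left this (hB.pos _ (hp.1 i).2.1)
    · intro j _ hj
      rw [map_smul, LinearMap.smul_apply, ← h1 j, hB.assoc, hp.2.1 j i hj, map_zero, smul_zero]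
    · exact fun h => absurd hi h
  · intro ht
    exact isPos_sum_smul h1 hp.2.1 fun i hi =>
      add_nonneg ht (hα.2 (Set.mem_image_of_mem _ hi))

end Eigen

section Topological

variable {V : Type u} [NonAssocCommRing V] [Module ℝ V]
variable {B : V →ₗ[ℝ] V →ₗ[ℝ] ℝ}

/-! ## Topology -/

/-- The algebra carries no topology; the one of the inner product is introduced only inside proofs
that pass to limits. -/
theorem exists_vectorSpace_topology (hB : IsAssocInner B) :
    ∃ _ : TopologicalSpace V, IsTopologicalAddGroup V ∧ ContinuousSMul ℝ V ∧ T2Space V := by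
  let core : InnerProductSpace.Core ℝ V :=
    { inner := fun x y => B x y
      conj_inner_symm := fun x y => by simpa using hB.symm y x
      re_inner_nonneg := fun x => by simpa using hB.nonneg x
      add_left := fun x y z => by simp
      smul_left := fun x y r => by simp
      definite := fun x hx => hB.eq_zero hx }
  let _ : NormedAddCommGroup V := core.toNormedAddCommGroup
  let _ : InnerProductSpace ℝ V := InnerProductSpace.ofCore core.toCore
  exact ⟨inferInstance, inferInstance, inferInstance, inferInstance⟩

variable [SMulCommClass ℝ V V] [IsScalarTower ℝ V V] [IsCommJordan V] [FiniteDimensional ℝ V]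
variable [TopologicalSpace V] [IsTopologicalAddGroup V] [ContinuousSMul ℝ V] [T2Space V]

theorem continuous_jordan_mul : Continuous fun z : V × V => z.1 * z.2 := by
  let b := Module.finBasis ℝ V
  have h : (fun z : V × V => z.1 * z.2) =
      fun z => ∑ i, b.coord i z.1 • LinearMap.mulLeft ℝ (b i) z.2 := by
    funext z
    conv_lhs => rw [← b.sum_repr z.1, Finset.sum_mul]
    exact Finset.sum_congr rfl fun i _ => smul_mul_assoc _ _ _
  rw [h]
  refine continuous_finsetSum _ fun i _ => Continuous.smul ?_ ?_
  · exact (LinearMap.continuous_of_finiteDimensional (b.coord i)).comp continuous_fst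
  · exact (LinearMap.continuous_of_finiteDimensional _).comp continuous_snd

theorem tendsto_jordan_mul {A : Type*} {l : Filter A} {f g : A → V} {x y : V}
    (hf : Tendsto f l (𝓝 x)) (hg : Tendsto g l (𝓝 y)) :
    Tendsto (fun i => f i * g i) l (𝓝 (x * y)) :=
  (continuous_jordan_mul.tendsto (x, y)).comp (hf.prodMk_nhds hg)

theorem tendsto_quadRep {A : Type*} {l : Filter A} {f g : A → V} {x y : V}
    (hf : Tendsto f l (𝓝 x)) (hg : Tendsto g l (𝓝 y)) :
    Tendsto (fun i => quadRep (f i) (g i)) l (𝓝 (quadRep x y)) := by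
  simp only [quadRep_apply]
  exact (((tendsto_jordan_mul hf (tendsto_jordan_mul hf hg)).const_smul (2 : ℝ))).sub
    (tendsto_jordan_mul (tendsto_jordan_mul hf hf) hg)

theorem tendsto_inner_left {A : Type*} {l : Filter A} {f : A → V} {x : V}
    (hf : Tendsto f l (𝓝 x)) (y : V) : Tendsto (fun i => B y (f i)) l (𝓝 (B y x)) :=
  ((LinearMap.continuous_of_finiteDimensional (B y)).tendsto x).comp hf

theorem isClosed_isPos (hB : IsAssocInner B) : IsClosed {x : V | IsPos x} := by
  have : {x : V | IsPos x} = ⋂ y : V, {x | 0 ≤ B (y * y) x} := by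
    ext x
    simp only [Set.mem_iInter]
    refine (isPos_iff hB).trans (forall_congr' fun y => ?_)
    rw [Set.mem_ofPred_eq, hB.assoc y y x, hB.symm y, mul_comm y x]
  rw [this]
  exact isClosed_iInter fun y =>
    isClosed_le continuous_const (LinearMap.continuous_of_finiteDimensional (B (y * y)))

theorem isPos_of_tendsto (hB : IsAssocInner B) {A : Type*} {l : Filter A} [l.NeBot] {f : A → V}
    {x : V} (hf : Tendsto f l (𝓝 x)) (h : ∀ᶠ i in l, IsPos (f i)) : IsPos x :=
  (isClosed_isPos hB).mem_of_tendsto hf h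

/-- A weighted sum of absolute coordinates in a basis. It lets vanishing errors be absorbed by small
multiples of the unit. -/
theorem exists_continuous_isPos_bound (hB : IsAssocInner B) :
    ∃ N : V → ℝ, Continuous N ∧ N 0 = 0 ∧
      ∀ x, IsPos (N x • (1 : V) + x) ∧ IsPos (N x • (1 : V) - x) := by
  let b := Module.finBasis ℝ V
  choose t ht0 ht1 ht2 using fun i => exists_isPos_smul_one_add hB (b i)
  have hsum : ∀ {s : Finset (Fin (Module.finrank ℝ V))} {f : Fin (Module.finrank ℝ V) → V},
      (∀ i, IsPos (f i)) → IsPos (∑ i ∈ s, f i) := fun {s f} hf =>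
    Finset.sum_induction f IsPos (fun _ _ => IsPos.add' hB) isPos_zero fun i _ => hf i
  have key : ∀ (r : ℝ) i, IsPos ((|r| * t i) • (1 : V) + r • b i) := by
    intro r i
    rcases le_total 0 r with hr | hr
    · rw [abs_of_nonneg hr, mul_smul, ← smul_add]
      exact (ht1 i).smul hr
    · have : (|r| * t i) • (1 : V) + r • b i = (-r) • (t i • (1 : V) - b i) := by
        rw [abs_of_nonpos hr, mul_smul, smul_sub, neg_smul r (b i), sub_neg_eq_add]
      rw [this]
      exact (ht2 i).smul (by linarith)
  refine ⟨fun x => ∑ i, |b.coord i x| * t i, ?_, by simp, fun x => ⟨?_, ?_⟩⟩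
  · refine continuous_finsetSum _ fun i _ => Continuous.mul ?_ continuous_const
    exact (LinearMap.continuous_of_finiteDimensional (b.coord i)).abs
  · conv => arg 1; arg 2; rw [← b.sum_repr x]
    rw [Finset.sum_smul, ← Finset.sum_add_distrib]
    exact hsum fun i => key _ i
  · conv => arg 1; arg 2; rw [← b.sum_repr x]
    rw [Finset.sum_smul, ← Finset.sum_sub_distrib]
    refine hsum fun i => ?_
    have := key (-b.coord i x) i
    rwa [abs_neg, neg_smul, ← sub_eq_add_neg] at this

/-- Each coordinate is v ↦ B(w, v) with −t·1 ≤ w ≤ t·1, hence at most t M in absolute value on this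
set. -/
theorem isCompact_isPos_inner_one_le (hB : IsAssocInner B) (M : ℝ) :
    IsCompact {v : V | IsPos v ∧ B 1 v ≤ M} := by
  let b := Module.finBasis ℝ V
  have hinj : Function.Injective B := by
    intro x y hxy
    refine sub_eq_zero.1 (hB.eq_zero ?_)
    have h0 : B (x - y) = 0 := by rw [map_sub, hxy, sub_self]
    rw [h0, LinearMap.zero_apply]
  have hsurj : Function.Surjective B :=
    (LinearMap.injective_iff_surjective_of_finrank_eq_finrank
      (Subspace.dual_finrank_eq (K := ℝ) (V := V)).symm).1 hinj
  choose w hw using fun i => hsurj (b.coord i)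
  choose t ht0 ht1 ht2 using fun i => exists_isPos_smul_one_add hB (w i)
  have hK : IsCompact (b.equivFunL.toHomeomorph ⁻¹'
      Set.Icc (fun i => -(t i * M)) (fun i => t i * M)) :=
    (b.equivFunL.toHomeomorph.isCompact_preimage).2 isCompact_Icc
  refine hK.of_isClosed_subset ?_ ?_
  · exact (isClosed_isPos hB).inter
      (isClosed_le (LinearMap.continuous_of_finiteDimensional (B 1)) continuous_const)
  · rintro v ⟨hv, hvM⟩
    have h1 : ∀ i, b.equivFunL v i = B (w i) v := fun i => by rw [hw]; rfl
    refine ⟨fun i => ?_, fun i => ?_⟩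
    · have h2 := (ht1 i).inner_nonneg hB hv
      simp only [map_add, map_smul, LinearMap.add_apply, LinearMap.smul_apply, smul_eq_mul] at h2
      change -(t i * M) ≤ b.equivFunL v i
      rw [h1]
      have := mul_le_mul_of_nonneg_left hvM (ht0 i)
      linarith
    · have h2 := (ht2 i).inner_nonneg hB hv
      simp only [map_sub, map_smul, LinearMap.sub_apply, LinearMap.smul_apply, smul_eq_mul] at h2
      change b.equivFunL v i ≤ t i * M
      rw [h1]
      have := mul_le_mul_of_nonneg_left hvM (ht0 i)
      linarith

theorem Ultrafilter.exists_tendsto_of_isPos (hB : IsAssocInner B) {A : Type*} (F : Ultrafilter A)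
    {f : A → V} {M : ℝ} (h : ∀ᶠ i in (F : Filter A), IsPos (f i) ∧ B 1 (f i) ≤ M) :
    ∃ x, Tendsto f F (𝓝 x) := by
  obtain ⟨x, -, hx⟩ := (isCompact_isPos_inner_one_le hB M).ultrafilter_le_nhds (F.map f)
    (by rw [le_principal_iff]; exact h)
  exact ⟨x, hx⟩

/-! ## One-sided limits -/

/-- Strict positivity on the corner P extends to the whole algebra once a large multiple of 1 − P is
added. Otherwise normalized positive v_n with B(w + n(1 − P), v_n) < 0 accumulate at some x. Then
B(1 − P, x) = 0, so Px = x and B(w, x) = B(U_P w, x) ≥ δ > 0, against B(w, x) ≤ 0. -/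
theorem exists_isPos_add_smul_one_sub (hB : IsAssocInner B) {P w : V} (hP : P * P = P) {δ : ℝ}
    (hδ : 0 < δ) (h : IsPos (quadRep P w - δ • P)) : ∃ T : ℝ, IsPos (w + T • (1 - P)) := by
  by_contra! hcon
  have hQ := one_sub_idem hP
  have hex : ∀ n : ℕ, ∃ v : V, IsPos v ∧ B 1 v = 1 ∧ B (w + (n : ℝ) • (1 - P)) v < 0 := by
    intro n
    have : ∃ c : V, c * c = c ∧ B (w + (n : ℝ) • (1 - P)) c < 0 := by
      by_contra! hc
      exact hcon n (isPos_of_inner_nonneg hB (one_mul 1) (one_mul _) fun c hc1 _ => hc c hc1)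
    obtain ⟨c, hc, hlt⟩ := this
    have hc0 : c ≠ 0 := by rintro rfl; simp at hlt
    have hpos : 0 < B 1 c := by
      have := hB.pos c hc0
      rwa [← mul_one c, hB.assoc, mul_one, hc] at this
    refine ⟨(B 1 c)⁻¹ • c, (isPos_of_idem hc).smul (inv_nonneg.2 hpos.le), ?_, ?_⟩
    · rw [map_smul, smul_eq_mul, inv_mul_cancel₀ hpos.ne']
    · rw [map_smul, smul_eq_mul]
      exact mul_neg_of_pos_of_neg (inv_pos.2 hpos) hlt
  choose v hv1 hv2 hv3 using hex
  obtain ⟨x, hx⟩ := (hyperfilter ℕ).exists_tendsto_of_isPos hB (f := v) (M := 1)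
    (Eventually.of_forall fun n => ⟨hv1 n, (hv2 n).le⟩)
  have hxpos : IsPos x := isPos_of_tendsto hB hx (Eventually.of_forall hv1)
  have hx1 : B 1 x = 1 := by
    refine tendsto_nhds_unique (tendsto_inner_left hx 1) ?_
    simp only [hv2]
    exact tendsto_const_nhds
  have hxm : ∀ m : ℕ, B (w + (m : ℝ) • (1 - P)) x ≤ 0 := by
    intro m
    refine le_of_tendsto (tendsto_inner_left hx _) ?_
    have : ∀ᶠ n in (hyperfilter ℕ : Filter ℕ), m ≤ n :=
      Nat.hyperfilter_le_atTop (eventually_ge_atTop m)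
    filter_upwards [this] with n hn
    refine le_trans ?_ (hv3 n).le
    have h0 := (isPos_of_idem hQ).inner_nonneg hB (hv1 n)
    simp only [map_add, map_smul, LinearMap.add_apply, LinearMap.smul_apply, smul_eq_mul]
    have : (m : ℝ) ≤ n := by exact_mod_cast hn
    gcongr
  have hx0 : B (1 - P) x = 0 := by
    refine le_antisymm ?_ ((isPos_of_idem hQ).inner_nonneg hB hxpos)
    by_contra! hlt
    obtain ⟨m, hm⟩ := exists_nat_gt (-B w x / B (1 - P) x)
    have := hxm m
    rw [div_lt_iff₀ hlt] at hm
    simp only [map_add, map_smul, LinearMap.add_apply, LinearMap.smul_apply, smul_eq_mul] at this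
    linarith
  have hPx : P * x = x := by
    have := (isPos_of_idem hQ).mul_eq_zero hB hxpos hx0
    rw [sub_mul, one_mul, sub_eq_zero] at this
    exact this.symm
  have h1 := h.inner_nonneg hB hxpos
  rw [map_sub, LinearMap.sub_apply, inner_quadRep hB, quadRep_of_mem hP hPx, map_smul,
    LinearMap.smul_apply, smul_eq_mul] at h1
  have h2 := hxm 0
  have h3 : B P x = 1 := by
    rw [map_sub, LinearMap.sub_apply, hx1] at hx0
    linarith
  rw [h3] at h1
  simp only [Nat.cast_zero, zero_smul, add_zero] at h2
  linarith

variable {A : Type*} {l : Filter A} {Pf af bf : A → V} {P a : V}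

/-- Compression by U_{P_i} removes b_i and keeps a_i; the cone is closed. -/
theorem isPos_of_tendsto_peirce (hB : IsAssocInner B) [l.NeBot] (hP : Tendsto Pf l (𝓝 P))
    (ha : Tendsto af l (𝓝 a)) (hidem : ∀ i, Pf i * Pf i = Pf i) (hPa : ∀ i, Pf i * af i = af i)
    (hPb : ∀ i, Pf i * bf i = 0) {t : ℝ} {tf : A → ℝ} (ht : Tendsto tf l (𝓝 t)) {x : V}
    (h : ∀ᶠ i in l, IsPos (tf i • (1 : V) + x + (af i + bf i))) :
    IsPos (t • P + quadRep P x + a) := by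
  refine isPos_of_tendsto hB (((ht.smul hP).add (tendsto_quadRep hP tendsto_const_nhds)).add ha) ?_
  filter_upwards [h] with i hi
  have := hi.quadRep hB (hidem i)
  rwa [map_add, map_add, map_add, map_smul, quadRep_one (hidem i), quadRep_of_mem (hidem i) (hPa i),
    quadRep_of_mul_eq_zero (hidem i) (hPb i), add_zero] at this

/-- Half of ε supplies the strict positivity on the corner, which costs T(1 − P); the other half
absorbs the errors a_i − a and T(P_i − P). Finally b_i eventually dominates T(1 − P_i). -/
theorem eventually_isPos_of_peirce (hB : IsAssocInner B) (hP : Tendsto Pf l (𝓝 P))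
    (ha : Tendsto af l (𝓝 a)) (hPP : P * P = P) (hPa : P * a = a)
    (hPb : ∀ T : ℝ, ∀ᶠ i in l, IsPos (bf i - T • (1 - Pf i)))
    {t ε : ℝ} (hε : 0 < ε) {x : V} (h : IsPos (t • P + quadRep P x + a)) :
    ∀ᶠ i in l, IsPos ((t + ε) • (1 : V) + x + (af i + bf i)) := by
  obtain ⟨N, hNc, hN0, hN⟩ := exists_continuous_isPos_bound (V := V) hB
  obtain ⟨T, hTP⟩ := exists_isPos_add_smul_one_sub hB (P := P)
    (w := (t + ε / 2) • (1 : V) + x + a) hPP (half_pos hε) (by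
      rw [map_add, map_add, map_smul, quadRep_one hPP, quadRep_of_mem hPP hPa]
      have : (t + ε / 2) • P + quadRep P x + a - (ε / 2) • P = t • P + quadRep P x + a := by
        rw [add_smul]; abel
      rwa [this])
  have hd : Tendsto (fun i => (af i - a) - T • (Pf i - P)) l (𝓝 0) := by
    have := (ha.sub_const a).sub ((hP.sub_const P).const_smul T)
    simpa using this
  have hNd : Tendsto (fun i => N ((af i - a) - T • (Pf i - P))) l (𝓝 0) := by
    have := (hNc.tendsto 0).comp hd
    rwa [hN0] at this
  filter_upwards [hNd.eventually (gt_mem_nhds (half_pos hε)), hPb T] with i hi1 hi2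
  have h1 := (hN ((af i - a) - T • (Pf i - P))).1.smul_add_of_le hB (one_mul 1) hi1.le
  have h3 := (hTP.add' hB h1).add' hB hi2
  have e : (t + ε / 2) • (1 : V) + x + a + T • (1 - P) +
      ((ε / 2) • (1 : V) + (af i - a - T • (Pf i - P))) + (bf i - T • (1 - Pf i)) =
      (t + ε) • (1 : V) + x + (af i + bf i) := by
    have : (t + ε) • (1 : V) = (t + ε / 2) • (1 : V) + (ε / 2) • (1 : V) := by
      rw [← add_smul]; congr 1; ring
    rw [this]
    simp only [smul_sub]
    abel
  rwa [e] at h3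

/-- The elements `u i` split as `a_i + b_i` along idempotents `P_i → P`, with `a_i ∈ V(P_i)`
converging to `a` and `b_i ∈ V(1 - P_i)` growing to infinity. -/
def HasPeirceLimit (l : Filter A) (u : A → V) (P a : V) : Prop :=
  P * P = P ∧ P * a = a ∧ ∃ Pf af bf : A → V, (∀ i, u i = af i + bf i) ∧ Tendsto Pf l (𝓝 P) ∧
    Tendsto af l (𝓝 a) ∧ (∀ i, Pf i * Pf i = Pf i) ∧ (∀ i, Pf i * af i = af i) ∧
    (∀ i, Pf i * bf i = 0) ∧ ∀ T : ℝ, ∀ᶠ i in l, IsPos (bf i - T • (1 - Pf i))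

theorem HasPeirceLimit.isPos (hB : IsAssocInner B) {u : A → V} (h : HasPeirceLimit l u P a)
    {t : ℝ} {x : V} (hf : ∃ᶠ i in l, IsPos (t • (1 : V) + x + u i)) :
    IsPos (t • P + quadRep P x + a) := by
  obtain ⟨-, -, Pf, af, bf, hu, hP, ha, h1, h2, h3, -⟩ := h
  have : (l ⊓ 𝓟 {i | IsPos (t • (1 : V) + x + u i)}).NeBot := frequently_mem_iff_neBot.1 hf
  refine isPos_of_tendsto_peirce hB (hP.mono_left inf_le_left) (ha.mono_left inf_le_left) h1 h2 h3
    (tendsto_const_nhds (x := t)) (l := l ⊓ 𝓟 {i | IsPos (t • (1 : V) + x + u i)}) ?_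
  refine eventually_inf_principal.2 (Eventually.of_forall fun i hi => ?_)
  rw [← hu]
  exact hi

theorem HasPeirceLimit.eventually (hB : IsAssocInner B) {u : A → V} (h : HasPeirceLimit l u P a)
    {t ε : ℝ} (hε : 0 < ε) {x : V} (hp : IsPos (t • P + quadRep P x + a)) :
    ∀ᶠ i in l, IsPos ((t + ε) • (1 : V) + x + u i) := by
  obtain ⟨hPP, hPa, Pf, af, bf, hu, hP, ha, h1, h2, h3, h4⟩ := h
  simp only [hu]
  exact eventually_isPos_of_peirce hB hP ha hPP hPa h4 hε hp

end Topological

/-! ## The detour cost -/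

section Detour

variable {M : Type u} {d : M → M → ℝ} {b : M} {h h' : M → ℝ}

/-- If h_y is close to h at x, the Lipschitz bound gives d(b,y) + h'(y) ≥ h'(x) − (d(x,y) − d(b,y)),
which is nearly h'(x) − h(x). -/
theorem le_detourCost (hlip : ∀ x y, h' x ≤ h' y + d x y) (x : M) :
    ((h' x - h x : ℝ) : EReal) ≤ detourCost d b h h' := by
  refine EReal.ge_of_forall_gt_iff_ge.1 fun z hz => ?_
  have hz' : z < h' x - h x := EReal.coe_lt_coe_iff.1 hz
  have hW : {f : M → ℝ | f x < h' x - z} ∈ 𝓝[horoCompactification d b] h := by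
    refine mem_nhdsWithin_of_mem_nhds ?_
    exact (continuous_apply x).continuousAt.eventually (gt_mem_nhds (by linarith))
  refine le_iSup₂_of_le _ hW (le_iInf₂ fun y hy => EReal.coe_le_coe_iff.2 ?_)
  have h1 : d x y - d b y < h' x - z := hy
  have := hlip x y
  linarith

theorem detourCost_le {A : Type*} {l : Filter A} [l.NeBot] {y : A → M}
    (hy : Tendsto (fun i => internalFunctional d b (y i)) l (𝓝 h)) {c : ℝ}
    (hc : ∀ᶠ i in l, d b (y i) + h' (y i) ≤ c) : detourCost d b h h' ≤ c := by
  refine iSup₂_le fun W hW => ?_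
  have hy' : Tendsto (fun i => internalFunctional d b (y i)) l (𝓝[horoCompactification d b] h) :=
    tendsto_nhdsWithin_iff.2 ⟨hy, Eventually.of_forall fun i => subset_closure ⟨y i, rfl⟩⟩
  obtain ⟨i, hi1, hi2⟩ := ((hy'.eventually hW).and hc).exists
  exact iInf₂_le_of_le (y i) hi1 (EReal.coe_le_coe_iff.2 hi2)

end Detour

/-! ### Limits along Peirce rays, Busemann points and detour costs -/

section Functionals

variable {V : Type u} [NonAssocCommRing V] [Module ℝ V]
variable {B : V →ₗ[ℝ] V →ₗ[ℝ] ℝ}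
variable [SMulCommClass ℝ V V] [IsScalarTower ℝ V V] [IsCommJordan V] [FiniteDimensional ℝ V]

theorem IsOrthPair.nontrivial {P Q : V} (h : IsOrthPair P Q) : Nontrivial V :=
  ⟨⟨_, _, h.ne_zero⟩⟩

theorem spectralDist_zero_left [Nontrivial V] (hB : IsAssocInner B) (x : V) :
    spectralDist 0 x = orderUnitNorm x := by
  rw [spectralDist, zero_sub, orderUnitNorm_neg hB]

theorem spectralDist_zero_right (x : V) : spectralDist x 0 = orderUnitNorm x := by
  rw [spectralDist, sub_zero]

theorem internalFunctional_le_iff [Nontrivial V] (hB : IsAssocInner B) {x z : V} {t : ℝ} :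
    internalFunctional spectralDist 0 z x ≤ t ↔
      IsPos (t • (1 : V) + x + (orderUnitNorm z • (1 : V) - z)) ∧
      IsPos (t • (1 : V) + (-x) + (orderUnitNorm z • (1 : V) + z)) := by
  unfold internalFunctional
  rw [spectralDist_zero_left hB, sub_le_iff_le_add, spectralDist, orderUnitNorm_le_iff hB]
  have e1 : (t + orderUnitNorm z) • (1 : V) + (x - z) =
      t • (1 : V) + x + (orderUnitNorm z • (1 : V) - z) := by rw [add_smul]; abel
  have e2 : (t + orderUnitNorm z) • (1 : V) - (x - z) =
      t • (1 : V) + (-x) + (orderUnitNorm z • (1 : V) + z) := by rw [add_smul]; abel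
  rw [e1, e2]

namespace IsOrthPair

variable {P Q : V}

theorem tendsto_internalFunctional (h : IsOrthPair P Q) (hB : IsAssocInner B) [TopologicalSpace V]
    [IsTopologicalAddGroup V] [ContinuousSMul ℝ V] [T2Space V] {A : Type*} {l : Filter A}
    {z : A → V} {a b : V}
    (h1 : HasPeirceLimit l (fun i => orderUnitNorm (z i) • (1 : V) - z i) P a)
    (h2 : HasPeirceLimit l (fun i => orderUnitNorm (z i) • (1 : V) + z i) Q b) :
    Tendsto (fun i => internalFunctional spectralDist 0 (z i)) l (𝓝 (pairFun P Q (a + b))) := by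
  have := h.nontrivial
  have hPa : P * a = a := h1.2.1
  have hQb : Q * b = b := h2.2.1
  have hab : a + b ∈ peirceSum P Q := Submodule.add_mem_sup
    ((mem_peirceOne h.idem_left).2 hPa) ((mem_peirceOne h.idem_right).2 hQb)
  have hle : ∀ x t, pairFun P Q (a + b) x ≤ t ↔ IsPos (t • P + quadRep P x + a) ∧
      IsPos (t • Q + quadRep Q (-x) + b) := by
    intro x t
    rw [h.pairFun_le_iff hB hab, map_add, map_add, quadRep_of_mem h.idem_left hPa,
      quadRep_of_mem h.idem_right hQb, map_neg,
      quadRep_of_mul_eq_zero h.idem_left (h.left_mul_of_mem_right hQb),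
      quadRep_of_mul_eq_zero h.idem_right (h.right_mul_of_mem_left hPa), add_zero, zero_add,
      sub_eq_add_neg]
  refine tendsto_pi_nhds.2 fun x => tendsto_order.2 ⟨fun c hc => ?_, fun c hc => ?_⟩
  · by_contra hcon
    have hf : ∃ᶠ i in l, internalFunctional spectralDist 0 (z i) x ≤ c := by
      rw [not_eventually] at hcon
      exact hcon.mono fun i hi => not_lt.1 hi
    refine not_le.2 hc ((hle x c).2 ⟨h1.isPos hB (hf.mono fun i hi => ?_),
      h2.isPos hB (hf.mono fun i hi => ?_)⟩)
    · exact ((internalFunctional_le_iff hB).1 hi).1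
    · exact ((internalFunctional_le_iff hB).1 hi).2
  · obtain ⟨h3, h4⟩ := (hle x _).1 le_rfl
    have hε : 0 < (c - pairFun P Q (a + b) x) / 2 := by linarith
    filter_upwards [h1.eventually hB hε h3, h2.eventually hB hε h4] with i hi1 hi2
    refine lt_of_le_of_lt ((internalFunctional_le_iff hB).2 ⟨hi1, hi2⟩) ?_
    linarith

theorem pairFun_le_add (h : IsOrthPair P Q)
    (hB : IsAssocInner B) {a : V} (ha : a ∈ peirceSum P Q) (x y : V) :
    pairFun P Q a x ≤ pairFun P Q a y + spectralDist x y := by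
  have := h.nontrivial
  rw [h.pairFun_le_iff hB ha]
  obtain ⟨h1, h2⟩ := (h.pairFun_le_iff hB ha).1 (le_refl (pairFun P Q a y))
  obtain ⟨h3, h4⟩ := orderUnitNorm_spec hB (x - y)
  have h5 := h1.add' hB (h3.quadRep hB h.idem_left)
  have h6 := h2.add' hB (h4.quadRep hB h.idem_right)
  rw [map_add, map_smul, quadRep_one h.idem_left, map_sub] at h5
  rw [map_sub, map_smul, quadRep_one h.idem_right, map_sub] at h6
  rw [add_smul, add_smul]
  constructor
  · convert h5 using 1
    unfold spectralDist; abel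
  · convert h6 using 1
    unfold spectralDist; abel

/-- The ray `t ↦ t (P - Q) - (U_P a - U_Q a)`, along which `h_y` converges to `pairFun P Q a`. -/
def _root_.peirceRay (P Q a : V) (t : ℝ) : V := t • (P - Q) - (quadRep P a - quadRep Q a)

theorem quadRep_left_ray (h : IsOrthPair P Q)
    (a : V) (t : ℝ) : quadRep P (peirceRay P Q a t) = t • P - quadRep P a := by
  simp only [peirceRay, map_sub, map_smul, quadRep_of_mem h.idem_left h.idem_left,
    quadRep_of_mul_eq_zero h.idem_left h.orth, h.quadRep_left_quadRep_right,
    quadRep_of_mem h.idem_left (idem_mul_quadRep h.idem_left a), sub_zero]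

theorem quadRep_right_ray (h : IsOrthPair P Q) (a : V) (t : ℝ) :
    quadRep Q (peirceRay P Q a t) = quadRep Q a - t • Q := by
  simp only [peirceRay, map_sub, map_smul, quadRep_of_mem h.idem_right h.idem_right,
    quadRep_of_mul_eq_zero h.idem_right h.symm.orth, h.quadRep_right_quadRep_left,
    quadRep_of_mem h.idem_right (idem_mul_quadRep h.idem_right a), zero_sub]
  rw [smul_neg, sub_neg_eq_add, neg_add_eq_sub]

theorem pairFun_ray (h : IsOrthPair P Q) (hB : IsAssocInner B) {a b : V} (ha : a ∈ peirceSum P Q)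
    (hb : b ∈ peirceSum P Q) (t : ℝ) :
    pairFun P Q b (peirceRay P Q a t) = -t + lam (P + Q) (a - b) := by
  unfold pairFun
  rw [h.quadRep_left_ray, h.quadRep_right_ray, ← h.lam_smul_add hB (Submodule.sub_mem _ ha hb)]
  congr 1
  conv_rhs => rw [h.mem_peirceSum.1 ha]
  rw [smul_add, neg_smul, neg_smul]
  abel

theorem pairFun_ray_self (h : IsOrthPair P Q)
    (hB : IsAssocInner B) {a : V} (ha : a ∈ peirceSum P Q) (t : ℝ) :
    pairFun P Q a (peirceRay P Q a t) = -t := by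
  rw [h.pairFun_ray hB ha ha, sub_self, lam_zero hB h.idem_add h.ne_zero, add_zero]

theorem isPos_of_lam_neg (h : IsOrthPair P Q) (hB : IsAssocInner B) {a : V} (ha : a ∈ peirceSum P Q)
    (hn : lam (P + Q) (-a) = 0) : IsPos (quadRep P a) ∧ IsPos (quadRep Q a) := by
  have := (lam_le_iff hB h.idem_add h.ne_zero
    (h.add_mul_of_mem (Submodule.neg_mem _ ha))).1 hn.le
  rw [zero_smul, zero_sub, neg_neg, h.isPos_iff_of_mem hB ha] at this
  exact this

theorem isPos_compl (h : IsOrthPair P Q) : IsPos (1 - P - Q) := by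
  rw [sub_sub]
  exact isPos_of_idem (one_sub_idem h.idem_add)

theorem exists_isPos_smul_sub (h : IsOrthPair P Q) (hB : IsAssocInner B) (a : V) : ∃ c : ℝ, 0 ≤ c ∧
    IsPos (c • P - quadRep P a) ∧ IsPos (c • Q - quadRep Q a) := by
  obtain ⟨c, hc, -, h1⟩ := exists_isPos_smul_one_add hB a
  have h2 := h1.quadRep hB h.idem_left
  have h3 := h1.quadRep hB h.idem_right
  rw [map_sub, map_smul, quadRep_one h.idem_left] at h2
  rw [map_sub, map_smul, quadRep_one h.idem_right] at h3
  exact ⟨c, hc, h2, h3⟩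

/-- The upper bound uses a ≥ 0 and t large against a. For the lower bound, a norm s gives (s − t)(P
+ Q) + a ≥ 0, so s ≥ t because the least eigenvalue of a is 0. -/
theorem orderUnitNorm_ray (h : IsOrthPair P Q)
    (hB : IsAssocInner B) {a : V} (ha : a ∈ peirceSum P Q)
    (hn : lam (P + Q) (-a) = 0) {t : ℝ} (ht : 0 ≤ t) (htP : IsPos ((2 * t) • P - quadRep P a))
    (htQ : IsPos ((2 * t) • Q - quadRep Q a)) : orderUnitNorm (peirceRay P Q a t) = t := by
  have := h.nontrivial
  obtain ⟨haP, haQ⟩ := h.isPos_of_lam_neg hB ha hn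
  refine le_antisymm ((orderUnitNorm_le_iff hB).2 ⟨?_, ?_⟩) ?_
  · have h1 := ((h.isPos_compl.smul ht).add' hB htP).add' hB haQ
    convert h1 using 1
    unfold peirceRay
    simp only [two_mul, add_smul, smul_sub]
    abel
  · have h1 := ((h.isPos_compl.smul ht).add' hB htQ).add' hB haP
    convert h1 using 1
    unfold peirceRay
    simp only [two_mul, add_smul, smul_sub]
    abel
  · obtain ⟨h1, h2⟩ := orderUnitNorm_spec hB (peirceRay P Q a t)
    have h3 := (h2.quadRep hB h.idem_left).add' hB (h1.quadRep hB h.idem_right)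
    rw [map_sub, map_smul, quadRep_one h.idem_left, map_add, map_smul, quadRep_one h.idem_right,
      h.quadRep_left_ray, h.quadRep_right_ray] at h3
    have h4 : lam (P + Q) (-a) ≤ orderUnitNorm (peirceRay P Q a t) - t := by
      rw [lam_le_iff hB h.idem_add h.ne_zero (h.add_mul_of_mem (Submodule.neg_mem _ ha))]
      generalize orderUnitNorm (peirceRay P Q a t) = s at h3 ⊢
      convert h3 using 1
      conv_lhs => rw [h.mem_peirceSum.1 ha]
      simp only [sub_smul, smul_add]
      abel
    rw [hn] at h4
    linarith

theorem orderUnitNorm_smul_sub_le (h : IsOrthPair P Q) (hB : IsAssocInner B) {s : ℝ} (hs : 0 ≤ s) :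
    orderUnitNorm (s • (P - Q)) ≤ s := by
  have := h.nontrivial
  have hP := (isPos_of_idem h.idem_left).smul (t := 2 * s) (by linarith)
  have hQ := (isPos_of_idem h.idem_right).smul (t := 2 * s) (by linarith)
  have hR := h.isPos_compl.smul hs
  refine (orderUnitNorm_le_iff hB).2 ⟨?_, ?_⟩
  · convert hR.add' hB hP using 1
    simp only [two_mul, add_smul, smul_sub]
    abel
  · convert hR.add' hB hQ using 1
    simp only [two_mul, add_smul, smul_sub]
    abel

theorem exists_norm_ray (h : IsOrthPair P Q) (hB : IsAssocInner B) {a : V} (ha : a ∈ peirceSum P Q)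
    (hn : lam (P + Q) (-a) = 0) : ∃ c : ℝ, 0 ≤ c ∧ IsPos (c • P - quadRep P a) ∧
      IsPos (c • Q - quadRep Q a) ∧ ∀ t, c ≤ t → orderUnitNorm (peirceRay P Q a t) = t := by
  obtain ⟨c, hc, h1, h2⟩ := h.exists_isPos_smul_sub hB a
  rw [sub_eq_add_neg] at h1 h2
  refine ⟨c, hc, by rwa [sub_eq_add_neg], by rwa [sub_eq_add_neg], fun t ht =>
    h.orderUnitNorm_ray hB ha hn (hc.trans ht) ?_ ?_⟩
  · rw [sub_eq_add_neg]
    exact h1.smul_add_of_le hB h.idem_left (by linarith)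
  · rw [sub_eq_add_neg]
    exact h2.smul_add_of_le hB h.idem_right (by linarith)

theorem tendsto_ray (h : IsOrthPair P Q) (hB : IsAssocInner B) {a : V} (ha : a ∈ peirceSum P Q)
    (hn : lam (P + Q) (-a) = 0) :
    Tendsto (fun t => internalFunctional spectralDist 0 (peirceRay P Q a t)) atTop
      (𝓝 (pairFun P Q a)) := by
  obtain ⟨τ, _, _, _⟩ := exists_vectorSpace_topology hB
  obtain ⟨c, hc, h1, h2, h3⟩ := h.exists_norm_ray hB ha hn
  have hP := idem_mul_quadRep h.idem_left a
  have hQ := idem_mul_quadRep h.idem_right a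
  have hPQ := h.left_mul_of_mem_right hQ
  have hQP := h.right_mul_of_mem_left hP
  have hR := h.isPos_compl
  -- The truncation at c makes the norm formula valid for every parameter, as the splitting in
  -- `HasPeirceLimit` is required at all indices. The idempotents are constant, and the growing part
  -- lives on the complementary corner.
  have key : Tendsto (fun t => internalFunctional spectralDist 0 (peirceRay P Q a (max c t))) atTop
      (𝓝 (pairFun P Q (quadRep P a + quadRep Q a))) := by
    refine h.tendsto_internalFunctional hB ?_ ?_
    · refine ⟨h.idem_left, hP, fun _ => P, fun _ => quadRep P a, fun t =>
        (2 * max c t) • Q - quadRep Q a + max c t • (1 - P - Q), fun t => ?_, tendsto_const_nhds,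
        tendsto_const_nhds, fun _ => h.idem_left, fun _ => hP, fun t => ?_, fun T => ?_⟩
      · beta_reduce
        rw [h3 _ (le_max_left c t), peirceRay]
        simp only [two_mul, add_smul, smul_sub]
        abel
      · simp only [mul_add, mul_sub, mul_smul_comm, h.orth, hPQ, mul_one, h.idem_left, sub_self,
          smul_zero, add_zero]
      · filter_upwards [eventually_ge_atTop (T + c), eventually_ge_atTop 0] with t ht ht0
        have hm := le_max_right c t
        have h4 := ((isPos_of_idem h.idem_right).smul
          (t := 2 * max c t - c - T) (by linarith)).add' hB h2
        have h5 := h4.add' hB (hR.smul (t := max c t - T) (by linarith))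
        convert h5 using 1
        simp only [sub_smul, smul_sub]
        abel
    · refine ⟨h.idem_right, hQ, fun _ => Q, fun _ => quadRep Q a, fun t =>
        (2 * max c t) • P - quadRep P a + max c t • (1 - P - Q), fun t => ?_, tendsto_const_nhds,
        tendsto_const_nhds, fun _ => h.idem_right, fun _ => hQ, fun t => ?_, fun T => ?_⟩
      · beta_reduce
        rw [h3 _ (le_max_left c t), peirceRay]
        simp only [two_mul, add_smul, smul_sub]
        abel
      · simp only [mul_add, mul_sub, mul_smul_comm, h.symm.orth, hQP, mul_one, h.idem_right,
          sub_zero, sub_self, smul_zero, add_zero]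
      · filter_upwards [eventually_ge_atTop (T + c), eventually_ge_atTop 0] with t ht ht0
        have hm := le_max_right c t
        have h4 := ((isPos_of_idem h.idem_left).smul
          (t := 2 * max c t - c - T) (by linarith)).add' hB h1
        have h5 := h4.add' hB (hR.smul (t := max c t - T) (by linarith))
        convert h5 using 1
        simp only [sub_smul, smul_sub]
        abel
  rw [← h.mem_peirceSum.1 ha] at key
  refine key.congr' ?_
  filter_upwards [eventually_ge_atTop c] with t ht
  rw [max_eq_right ht]

theorem pairFun_mem_busemannPoints (h : IsOrthPair P Q)
    (hB : IsAssocInner B) {a : V} (ha : a ∈ peirceSum P Q)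
    (hn : lam (P + Q) (-a) = 0) : pairFun P Q a ∈ busemannPoints spectralDist (0 : V) := by
  have := h.nontrivial
  obtain ⟨c, hc, -, -, h3⟩ := h.exists_norm_ray hB ha hn
  have ht := h.tendsto_ray hB ha hn
  -- The index set is lifted to the universe of V, and the ray starts at c, where norms become
  -- exact.
  refine ⟨⟨mem_closure_of_tendsto ht (Eventually.of_forall fun t => ⟨_, rfl⟩), ?_⟩, ULift ℕ,
    inferInstance, inferInstance, inferInstance, fun n => peirceRay P Q a (n.down + c), ⟨0, ?_⟩, ?_⟩
  -- An internal functional is bounded below by −d(0,y), whereas this function equals −t along the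
  -- ray.
  · rintro ⟨y, hy⟩
    have h1 := h.pairFun_ray_self hB ha (spectralDist 0 y + 1)
    rw [← hy, internalFunctional] at h1
    have h2 : 0 ≤ spectralDist (peirceRay P Q a (spectralDist 0 y + 1)) y := orderUnitNorm_nonneg _
    linarith
  · intro ε hε
    refine ⟨⟨0⟩, fun n m _ hmn => ?_⟩
    have hmn' : (m.down : ℝ) ≤ n.down := by exact_mod_cast (ULift.down_le.2 hmn)
    rw [spectralDist_zero_right, spectralDist_zero_right, h3 _ (by simp), h3 _ (by simp)]
    have e : peirceRay P Q a (n.down + c) - peirceRay P Q a (m.down + c) =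
        ((n.down : ℝ) - m.down) • (P - Q) := by
      unfold peirceRay
      simp only [add_smul, sub_smul, smul_sub]
      abel
    have := h.orderUnitNorm_smul_sub_le hB (sub_nonneg.2 hmn')
    rw [← e] at this
    change spectralDist _ _ ≤ _ at this
    linarith
  · intro z
    have hcomp : Tendsto (fun n : ULift.{u} ℕ => (n.down : ℝ) + c) atTop atTop := by
      refine tendsto_atTop_add_const_right _ c (tendsto_natCast_atTop_atTop.comp ?_)
      refine tendsto_atTop_atTop.2 fun b => ⟨⟨b⟩, fun n hn => ULift.down_le.2 hn⟩
    exact (tendsto_pi_nhds.1 ht z).comp hcomp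

theorem detourCost_pairFun (h : IsOrthPair P Q)
    (hB : IsAssocInner B) {a b : V} (ha : a ∈ peirceSum P Q)
    (hn : lam (P + Q) (-a) = 0) (hb : b ∈ peirceSum P Q) :
    detourCost spectralDist 0 (pairFun P Q a) (pairFun P Q b) = (lam (P + Q) (a - b) : ℝ) := by
  have := h.nontrivial
  refine le_antisymm ?_ ?_
  · refine detourCost_le (h.tendsto_ray hB ha hn) ?_
    obtain ⟨c, hc, -, -, h3⟩ := h.exists_norm_ray hB ha hn
    filter_upwards [eventually_ge_atTop c] with t ht
    rw [spectralDist_zero_left hB, h3 t ht, h.pairFun_ray hB ha hb]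
    linarith
  · have := le_detourCost (b := 0) (h := pairFun P Q a) (h.pairFun_le_add hB hb) (peirceRay P Q a 0)
    rwa [h.pairFun_ray hB ha hb, h.pairFun_ray_self hB ha, neg_zero, sub_zero, zero_add] at this

theorem detourDist_pairFun (h : IsOrthPair P Q)
    (hB : IsAssocInner B) {a b : V} (ha : a ∈ peirceSum P Q)
    (hna : lam (P + Q) (-a) = 0) (hb : b ∈ peirceSum P Q) (hnb : lam (P + Q) (-b) = 0) :
    detourDist spectralDist 0 (pairFun P Q a) (pairFun P Q b) =
      (varNorm (peirceSum P Q) (P + Q) (a - b) : ℝ) := by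
  unfold detourDist
  rw [h.detourCost_pairFun hB ha hna hb, h.detourCost_pairFun hB hb hnb ha,
    h.varNorm_peirceSum hB (Submodule.sub_mem _ ha hb), neg_sub, EReal.coe_add]

/-- A finite cost bounds h' − h above by c. Along the ray of h this reads h' ≤ c − t; the
coefficients of t in the two positivity conditions are −U_{P'}(1 − P + Q) and −U_{Q'}(1 − Q + P), so
both are positive. Being compressions of positive elements up to sign, their summands vanish. -/
theorem mul_eq_zero_of_detourCost_lt_top (h : IsOrthPair P Q)
    (hB : IsAssocInner B) {a : V} (ha : a ∈ peirceSum P Q)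
    {P' Q' a' : V} (h' : IsOrthPair P' Q') (ha' : a' ∈ peirceSum P' Q')
    (hlt : detourCost spectralDist 0 (pairFun P Q a) (pairFun P' Q' a') < ⊤) :
    P' * (1 - P) = 0 ∧ Q' * (1 - Q) = 0 := by
  obtain ⟨c, hc⟩ := EReal.exists_between_coe_real hlt
  have hle : ∀ x, pairFun P' Q' a' x - pairFun P Q a x ≤ c := fun x =>
    EReal.coe_le_coe_iff.1 ((le_detourCost (h'.pairFun_le_add hB ha') x).trans hc.1.le)
  -- Recession: divide by t and let 1/t tend to 0.
  have hrec : ∀ y z : V, (∀ t : ℝ, 0 < t → IsPos (t • y + z)) → IsPos y := by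
    intro y z hyz
    have := isPos_of_forall_gt hB (e := z) (z := y) (s := 0) fun s hs => by
      have := (hyz s⁻¹ (inv_pos.2 hs)).smul hs.le
      rwa [smul_add, smul_smul, mul_inv_cancel₀ hs.ne', one_smul, add_comm] at this
    rwa [zero_smul, zero_add] at this
  have hray : ∀ t : ℝ, IsPos ((c - t) • P' + quadRep P' (peirceRay P Q a t) + quadRep P' a') ∧
      IsPos ((c - t) • Q' - quadRep Q' (peirceRay P Q a t) + quadRep Q' a') := by
    intro t
    rw [← h'.pairFun_le_iff hB ha']
    have := hle (peirceRay P Q a t)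
    rw [h.pairFun_ray_self hB ha] at this
    linarith
  have hP := hrec (-quadRep P' (1 - P + Q)) (c • P' - quadRep P' (quadRep P a - quadRep Q a) +
      quadRep P' a') fun t _ => by
    convert (hray t).1 using 1
    simp only [peirceRay, map_sub, map_add, map_smul, quadRep_one h'.idem_left, sub_smul, smul_neg,
      smul_sub, smul_add]
    abel
  have hQ := hrec (-quadRep Q' (1 - Q + P)) (c • Q' + quadRep Q' (quadRep P a - quadRep Q a) +
      quadRep Q' a') fun t _ => by
    convert (hray t).2 using 1
    simp only [peirceRay, map_sub, map_add, map_smul, quadRep_one h'.idem_right, sub_smul, smul_neg,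
      smul_sub, smul_add]
    abel
  have h1P := isPos_of_idem (one_sub_idem h.idem_left)
  have h1Q := isPos_of_idem (one_sub_idem h.idem_right)
  constructor
  · refine h1P.idem_mul_eq_zero hB h'.idem_left ((h1P.quadRep hB h'.idem_left).eq_zero hB ?_)
    have := hP.add' hB ((isPos_of_idem h.idem_right).quadRep hB h'.idem_left)
    rwa [map_add, neg_add, add_assoc, neg_add_cancel, add_zero] at this
  · refine h1Q.idem_mul_eq_zero hB h'.idem_right ((h1Q.quadRep hB h'.idem_right).eq_zero hB ?_)
    have := hQ.add' hB ((isPos_of_idem h.idem_left).quadRep hB h'.idem_right)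
    rwa [map_add, neg_add, add_assoc, neg_add_cancel, add_zero] at this

theorem eq_of_detourDist_lt_top (h : IsOrthPair P Q)
    (hB : IsAssocInner B) {a : V} (ha : a ∈ peirceSum P Q)
    {P' Q' a' : V} (h' : IsOrthPair P' Q') (ha' : a' ∈ peirceSum P' Q')
    (hlt : detourDist spectralDist 0 (pairFun P Q a) (pairFun P' Q' a') < ⊤) :
    P = P' ∧ Q = Q' := by
  -- In `EReal` the sum ⊤ + ⊥ is ⊥, so a finite sum bounds both costs only once neither is ⊥.
  have hbot : ∀ {P Q a P' Q' a' : V}, IsOrthPair P' Q' → a' ∈ peirceSum P' Q' →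
      detourCost spectralDist 0 (pairFun P Q a) (pairFun P' Q' a') ≠ ⊥ := by
    intro P Q a P' Q' a' h' ha'
    exact ((EReal.bot_lt_coe _).trans_le (le_detourCost (h'.pairFun_le_add hB ha') 0)).ne'
  unfold detourDist at hlt
  have h1 : detourCost spectralDist 0 (pairFun P Q a) (pairFun P' Q' a') < ⊤ := by
    refine lt_top_iff_ne_top.2 fun htop => ?_
    rw [htop, EReal.top_add_of_ne_bot (hbot h ha)] at hlt
    exact lt_irrefl _ hlt
  have h2 : detourCost spectralDist 0 (pairFun P' Q' a') (pairFun P Q a) < ⊤ := by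
    refine lt_top_iff_ne_top.2 fun htop => ?_
    rw [htop, EReal.add_top_of_ne_bot (hbot h' ha')] at hlt
    exact lt_irrefl _ hlt
  obtain ⟨h3, h4⟩ := h.mul_eq_zero_of_detourCost_lt_top hB ha h' ha' h1
  obtain ⟨h5, h6⟩ := h'.mul_eq_zero_of_detourCost_lt_top hB ha' h ha h2
  exact ⟨idem_eq_of_mul_one_sub_eq_zero h5 h3, idem_eq_of_mul_one_sub_eq_zero h6 h4⟩

end IsOrthPair

end Functionals

section Classification

variable {V : Type u} [NonAssocCommRing V] [Module ℝ V]
variable {B : V →ₗ[ℝ] V →ₗ[ℝ] ℝ}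
variable [SMulCommClass ℝ V V] [IsScalarTower ℝ V V] [IsCommJordan V] [FiniteDimensional ℝ V]

/-! ## Classification of the horofunctions -/

/-- Along an ultrafilter each coefficient is either bounded, hence convergent, or eventually above
every T. The bounded indices span the limiting corner. -/
theorem Ultrafilter.exists_hasPeirceLimit [TopologicalSpace V]
    [IsTopologicalAddGroup V] [ContinuousSMul ℝ V] [T2Space V] {A ι : Type*} [Fintype ι]
    [DecidableEq ι] (F : Ultrafilter A) {c : A → ι → V} {p : ι → V}
    (h1 : ∀ z i, c z i * c z i = c z i) (h2 : ∀ z i j, i ≠ j → c z i * c z j = 0)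
    (h3 : ∀ z, ∑ i, c z i = 1) (hlim : ∀ i, Tendsto (fun z => c z i) F (𝓝 (p i)))
    (hp1 : ∀ i, p i * p i = p i) (hp2 : ∀ i j, i ≠ j → p i * p j = 0)
    {μ : A → ι → ℝ} (hμ : ∀ z i, 0 ≤ μ z i) :
    ∃ (I : Finset ι) (a : V), (∀ i ∈ I, ∃ M, ∀ᶠ z in (F : Filter A), μ z i ≤ M) ∧
      HasPeirceLimit F (fun z => ∑ i, μ z i • c z i) (∑ i ∈ I, p i) a := by
  classical
  let I : Finset ι := Finset.univ.filter fun i => ∃ M, ∀ᶠ z in (F : Filter A), μ z i ≤ M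
  have hI : ∀ i ∈ I, ∃ M, ∀ᶠ z in (F : Filter A), μ z i ≤ M :=
      fun i hi => (Finset.mem_filter.1 hi).2
  have hα : ∀ i, ∃ α, i ∈ I → Tendsto (fun z => μ z i) F (𝓝 α) := by
    intro i
    by_cases hi : i ∈ I
    · obtain ⟨M, hM⟩ := hI i hi
      obtain ⟨α, -, hα⟩ := (isCompact_Icc (a := (0 : ℝ)) (b := M)).ultrafilter_le_nhds
        (F.map fun z => μ z i) (by
          rw [le_principal_iff]
          exact hM.mono fun z hz => ⟨hμ z i, hz⟩)
      exact ⟨α, fun _ => hα⟩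
    · exact ⟨0, fun h => absurd h hi⟩
  choose α hα using hα
  have hcompl : ∀ z, 1 - ∑ i ∈ I, c z i = ∑ i ∈ Iᶜ, c z i := by
    intro z
    rw [← h3 z, ← Finset.sum_add_sum_compl I, add_sub_cancel_left]
  refine ⟨I, ∑ i ∈ I, α i • p i, hI, ?_, sum_idem_mul_sum_smul hp1 hp2 α,
    fun z => ∑ i ∈ I, c z i, fun z => ∑ i ∈ I, μ z i • c z i, fun z => ∑ i ∈ Iᶜ, μ z i • c z i,
    fun z => (Finset.sum_add_sum_compl I _).symm, tendsto_finsetSum _ fun i _ => hlim i,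
    tendsto_finsetSum _ fun i hi => (hα i hi).smul (hlim i), fun z => ?_,
    fun z => sum_idem_mul_sum_smul (h1 z) (h2 z) _, fun z => ?_, fun T => ?_⟩
  · rw [sum_idem_mul_sum_idem hp1 hp2, Finset.inter_self]
  · rw [sum_idem_mul_sum_idem (h1 z) (h2 z), Finset.inter_self]
  · rw [Finset.sum_mul]
    refine Finset.sum_eq_zero fun i hi => ?_
    rw [Finset.mul_sum]
    refine Finset.sum_eq_zero fun j hj => ?_
    rw [mul_smul_comm, h2 z i j, smul_zero]
    rintro rfl
    exact Finset.mem_compl.1 hj hi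
  · have hT : ∀ i ∈ Iᶜ, ∀ᶠ z in (F : Filter A), T ≤ μ z i := by
      intro i hi
      have : ¬ ∀ᶠ z in (F : Filter A), μ z i ≤ T := fun h =>
        Finset.mem_compl.1 hi (Finset.mem_filter.2 ⟨Finset.mem_univ i, T, h⟩)
      filter_upwards [Ultrafilter.eventually_not.2 this] with z hz using (not_le.1 hz).le
    filter_upwards [(Filter.eventually_all_finset Iᶜ).2 hT] with z hz
    rw [hcompl, Finset.smul_sum, ← Finset.sum_sub_distrib]
    simp only [← sub_smul]
    exact isPos_sum_smul (h1 z) (h2 z) fun i hi => sub_nonneg.2 (hz i hi)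

theorem continuous_orderUnitNorm [Nontrivial V] (hB : IsAssocInner B) [TopologicalSpace V]
    [IsTopologicalAddGroup V] [ContinuousSMul ℝ V] [T2Space V] :
    Continuous (orderUnitNorm : V → ℝ) := by
  obtain ⟨N, hNc, hN0, hN⟩ := exists_continuous_isPos_bound (V := V) hB
  have hle : ∀ x, orderUnitNorm x ≤ N x := fun x => (orderUnitNorm_le_iff hB).2 (hN x)
  refine continuous_iff_continuousAt.2 fun x => tendsto_iff_dist_tendsto_zero.2 ?_
  have h0 : Tendsto (fun y => N (y - x)) (𝓝 x) (𝓝 0) := by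
    have : Continuous fun y => N (y - x) := hNc.comp (continuous_id.sub continuous_const)
    simpa [hN0] using this.tendsto x
  refine squeeze_zero (fun _ => dist_nonneg) (fun y => ?_) h0
  rw [Real.dist_eq, abs_le]
  have h1 := orderUnitNorm_add_le hB (y - x) x
  have h2 := orderUnitNorm_add_le hB (x - y) y
  rw [sub_add_cancel] at h1 h2
  rw [← orderUnitNorm_neg hB (x - y), neg_sub] at h2
  have h3 := hle (y - x)
  constructor <;> linarith

/-- Decompose each z spectrally and pass to the limit along an ultrafilter. P collects the indices
where ‖z‖ − l_i stays bounded, Q those where ‖z‖ + l_i does. The limit idempotents need not be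
primitive or nonzero. -/
theorem exists_eq_pairFun [Nontrivial V] (hB : IsAssocInner B) {g : V → ℝ}
    (hg : g ∈ horoBoundary spectralDist (0 : V)) :
    ∃ P Q a : V, IsOrthPair P Q ∧ a ∈ peirceSum P Q ∧ lam (P + Q) (-a) = 0 ∧
      g = pairFun P Q a := by
  classical
  obtain ⟨τ, _, _, _⟩ := exists_vectorSpace_topology hB
  have hne : (comap (internalFunctional spectralDist (0 : V)) (𝓝 g)).NeBot := by
    rw [comap_neBot_iff]
    intro t ht
    obtain ⟨_, h1, y, rfl⟩ := mem_closure_iff_nhds.1 hg.1 t ht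
    exact ⟨y, h1⟩
  let F := Ultrafilter.of (comap (internalFunctional spectralDist (0 : V)) (𝓝 g))
  have hF : Tendsto (internalFunctional spectralDist (0 : V)) F (𝓝 g) :=
    tendsto_comap.mono_left (Ultrafilter.of_le _)
  choose c l h1 h2 _ h4 h5 h6 using fun z : V =>
    exists_spectral hB (e := 1) (x := z) (one_mul 1) (one_mul z)
  have hinner : ∀ z i, B z (c z i) = l z i * B (c z i) (c z i) := by
    intro z i
    rw [← inner_sum_smul_idem hB (h1 z) (h2 z), ← h5]
  have hone : ∀ z i, B 1 (c z i) = B (c z i) (c z i) := by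
    intro z i
    conv_rhs => rw [← mul_one (c z i), hB.assoc, mul_one, h1]
  have hμ : ∀ z i, 0 ≤ orderUnitNorm z - l z i ∧ 0 ≤ orderUnitNorm z + l z i := by
    intro z i
    by_cases hc : c z i = 0
    · rw [h6 z i hc, sub_zero, add_zero]
      exact ⟨orderUnitNorm_nonneg z, orderUnitNorm_nonneg z⟩
    · obtain ⟨h7, h8⟩ := orderUnitNorm_spec hB z
      have hc1 := isPos_of_idem (h1 z i)
      have h9 := h7.inner_nonneg hB hc1
      have h10 := h8.inner_nonneg hB hc1
      simp only [map_add, map_sub, map_smul, LinearMap.add_apply, LinearMap.sub_apply,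
        LinearMap.smul_apply, smul_eq_mul, hinner, hone, ← add_mul, ← sub_mul] at h9 h10
      exact ⟨nonneg_of_mul_nonneg_left h10 (hB.pos _ hc),
        nonneg_of_mul_nonneg_left h9 (hB.pos _ hc)⟩
  have hlim : ∀ i, ∃ p, Tendsto (fun z => c z i) F (𝓝 p) := by
    intro i
    refine F.exists_tendsto_of_isPos hB (M := B 1 1) (Eventually.of_forall fun z =>
      ⟨isPos_of_idem (h1 z i), ?_⟩)
    have := (isPos_of_idem (one_mul (1 : V))).inner_nonneg hB
      (isPos_of_idem (one_sub_idem (h1 z i)))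
    rw [map_sub] at this
    linarith
  choose p hp using hlim
  have hp1 : ∀ i, p i * p i = p i := fun i =>
    tendsto_nhds_unique (tendsto_jordan_mul (hp i) (hp i)) (by simpa only [h1] using hp i)
  have hp2 : ∀ i j, i ≠ j → p i * p j = 0 := fun i j hij =>
    tendsto_nhds_unique (tendsto_jordan_mul (hp i) (hp j))
      (by simpa only [h2 _ i j hij] using tendsto_const_nhds)
  obtain ⟨I, a, hI, hPa⟩ := F.exists_hasPeirceLimit h1 h2 h4 hp hp1 hp2 fun z i => (hμ z i).1
  obtain ⟨J, b, hJ, hQb⟩ := F.exists_hasPeirceLimit h1 h2 h4 hp hp1 hp2 fun z i => (hμ z i).2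
  have e1 : ∀ z, ∑ i, (orderUnitNorm z - l z i) • c z i = orderUnitNorm z • (1 : V) - z := by
    intro z
    simp only [sub_smul]
    rw [Finset.sum_sub_distrib, ← Finset.smul_sum, h4, ← h5]
  have e2 : ∀ z, ∑ i, (orderUnitNorm z + l z i) • c z i = orderUnitNorm z • (1 : V) + z := by
    intro z
    simp only [add_smul]
    rw [Finset.sum_add_distrib, ← Finset.smul_sum, h4, ← h5]
  simp only [e1] at hPa
  simp only [e2] at hQb
  -- A common index would bound 2‖z‖, so z would converge along the ultrafilter and g would be
  -- internal.
  have hdisj : I ∩ J = ∅ := by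
    by_contra hne
    obtain ⟨i, hi⟩ := Finset.nonempty_iff_ne_empty.2 hne
    obtain ⟨M₁, hM₁⟩ := hI i (Finset.mem_inter.1 hi).1
    obtain ⟨M₂, hM₂⟩ := hJ i (Finset.mem_inter.1 hi).2
    set M := M₁ + M₂ with hM
    -- Compactness is available for positive elements only, hence the shift by M.
    obtain ⟨x, hx⟩ := F.exists_tendsto_of_isPos hB (f := fun z => M • (1 : V) + z)
      (M := (2 * M) * B 1 1) (by
        filter_upwards [hM₁, hM₂] with z hz₁ hz₂
        have h0 := orderUnitNorm_nonneg z
        obtain ⟨h7, h8⟩ := (orderUnitNorm_le_iff hB (x := z) (t := M)).1 (by linarith)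
        refine ⟨h7, ?_⟩
        have := (isPos_of_idem (one_mul (1 : V))).inner_nonneg hB h8
        simp only [map_sub, map_add, map_smul, smul_eq_mul] at this ⊢
        linarith)
    have hx' : Tendsto (fun z : V => z) F (𝓝 (x - M • (1 : V))) := by
      simpa using hx.sub_const (M • (1 : V))
    refine hg.2 ⟨x - M • (1 : V), ?_⟩
    refine tendsto_nhds_unique ?_ hF
    refine tendsto_pi_nhds.2 fun y => ?_
    have hc : Continuous fun z : V => internalFunctional spectralDist 0 z y := by
      have := continuous_orderUnitNorm (V := V) hB
      unfold internalFunctional spectralDist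
      exact (this.comp (continuous_const.sub continuous_id)).sub
        (this.comp (continuous_const.sub continuous_id))
    exact (hc.tendsto _).comp hx'
  set P := ∑ i ∈ I, p i
  set Q := ∑ i ∈ J, p i
  have hPQ : P * Q = 0 := by
    rw [sum_idem_mul_sum_idem hp1 hp2, hdisj, Finset.sum_empty]
  have hzero : ∀ z, internalFunctional spectralDist (0 : V) z 0 = 0 := fun z => sub_self _
  have hsum : P + Q ≠ 0 := by
    intro h0
    have hP0 : P = 0 := by
      have := congrArg (P * ·) h0
      simpa only [mul_add, hPa.1, hPQ, add_zero, mul_zero] using this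
    have hQ0 : Q = 0 := by rwa [hP0, zero_add] at h0
    have ha0 : a = 0 := by rw [← hPa.2.1, hP0, zero_mul]
    have hb0 : b = 0 := by rw [← hQb.2.1, hQ0, zero_mul]
    -- With both corners zero the limiting conditions hold for every t; t = −2 and ε = 1 yield
    -- h_z(0) ≤ −1, although h_z(0) = 0.
    have h7 := hPa.eventually hB (t := -2) (x := 0) one_pos
      (by rw [map_zero, hP0, ha0, smul_zero, add_zero, add_zero]; exact isPos_zero)
    have h8 := hQb.eventually hB (t := -2) (x := -0) one_pos
      (by rw [map_neg, map_zero, hQ0, hb0, smul_zero, neg_zero, add_zero, add_zero]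
          exact isPos_zero)
    obtain ⟨z, hz⟩ := (h7.and h8).exists
    have := (internalFunctional_le_iff hB).2 hz
    rw [hzero] at this
    norm_num at this
  have hpair : IsOrthPair P Q := ⟨hPa.1, hQb.1, hPQ, hsum⟩
  have hgeq : g = pairFun P Q (a + b) :=
    tendsto_nhds_unique hF (hpair.tendsto_internalFunctional hB hPa hQb)
  refine ⟨P, Q, a + b, hpair, Submodule.add_mem_sup ((mem_peirceOne hpair.idem_left).2 hPa.2.1)
    ((mem_peirceOne hpair.idem_right).2 hQb.2.1), ?_, hgeq⟩
  -- The normalization Λ(−a) = 0 is the value of g at the basepoint.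
  have hg0 : g 0 = 0 := by
    refine tendsto_nhds_unique (tendsto_pi_nhds.1 hF 0) ?_
    simp only [hzero]
    exact tendsto_const_nhds
  rw [hgeq, pairFun] at hg0
  simpa using hg0

end Classification

section Part

variable {V : Type u} [NonAssocCommRing V] [Module ℝ V]
variable {B : V →ₗ[ℝ] V →ₗ[ℝ] ℝ}
variable [SMulCommClass ℝ V V] [IsScalarTower ℝ V V] [IsCommJordan V] [FiniteDimensional ℝ V]

/-! ## Parts -/

/-- The horofunction attached to the class of `x` modulo `ℝ (P + Q)`. -/
noncomputable def partFun (P Q x : V) : V → ℝ := pairFun P Q (lam (P + Q) (-x) • (P + Q) + x)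

namespace IsOrthPair

variable {P Q : V}

theorem normalize_mem (h : IsOrthPair P Q) {x : V} (hx : x ∈ peirceSum P Q) :
    lam (P + Q) (-x) • (P + Q) + x ∈ peirceSum P Q :=
  Submodule.add_mem _ (Submodule.smul_mem _ _ h.add_mem) hx

theorem lam_neg_normalize (h : IsOrthPair P Q)
    (hB : IsAssocInner B) {x : V} (hx : x ∈ peirceSum P Q) :
    lam (P + Q) (-(lam (P + Q) (-x) • (P + Q) + x)) = 0 := by
  rw [neg_add, ← neg_smul, h.lam_smul_add hB (Submodule.neg_mem _ hx), neg_add_cancel]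

theorem partFun_of_lam_neg {x : V} (hn : lam (P + Q) (-x) = 0) : partFun P Q x = pairFun P Q x := by
  rw [partFun, hn, zero_smul, zero_add]

theorem varNorm_smul_add (h : IsOrthPair P Q)
    (hB : IsAssocInner B) {z : V} (hz : z ∈ peirceSum P Q) (s : ℝ) :
    varNorm (peirceSum P Q) (P + Q) (s • (P + Q) + z) = varNorm (peirceSum P Q) (P + Q) z := by
  rw [h.varNorm_peirceSum hB hz, h.varNorm_peirceSum hB
    (Submodule.add_mem _ (Submodule.smul_mem _ _ h.add_mem) hz), neg_add, ← neg_smul,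
    h.lam_smul_add hB hz, h.lam_smul_add hB (Submodule.neg_mem _ hz)]
  ring

theorem detourDist_partFun (h : IsOrthPair P Q)
    (hB : IsAssocInner B) {x y : V} (hx : x ∈ peirceSum P Q)
    (hy : y ∈ peirceSum P Q) :
    detourDist spectralDist 0 (partFun P Q x) (partFun P Q y) =
      (varNorm (peirceSum P Q) (P + Q) (x - y) : ℝ) := by
  unfold partFun
  rw [h.detourDist_pairFun hB (h.normalize_mem hx) (h.lam_neg_normalize hB hx) (h.normalize_mem hy)
    (h.lam_neg_normalize hB hy), add_sub_add_comm, ← sub_smul,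
    h.varNorm_smul_add hB (Submodule.sub_mem _ hx hy)]

theorem partFun_mem_busemannPoints (h : IsOrthPair P Q)
    (hB : IsAssocInner B) {x : V} (hx : x ∈ peirceSum P Q) :
    partFun P Q x ∈ busemannPoints spectralDist (0 : V) :=
  h.pairFun_mem_busemannPoints hB (h.normalize_mem hx) (h.lam_neg_normalize hB hx)

/-- Equal functions have the same detour costs as a function to itself, namely 0, so Λ of the
difference of the normalized parameters is 0 in both directions and the parameters agree. -/
theorem partFun_eq_iff (h : IsOrthPair P Q) (hB : IsAssocInner B) {x y : V} (hx : x ∈ peirceSum P Q)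
    (hy : y ∈ peirceSum P Q) :
    partFun P Q x = partFun P Q y ↔ x - y ∈ Submodule.span ℝ {P + Q} := by
  rw [Submodule.mem_span_singleton]
  constructor
  · intro heq
    have hcost : ∀ {u v : V}, u ∈ peirceSum P Q → v ∈ peirceSum P Q →
        partFun P Q u = partFun P Q v → lam (P + Q) ((lam (P + Q) (-u) • (P + Q) + u) -
          (lam (P + Q) (-v) • (P + Q) + v)) = 0 := by
      intro u v hu hv huv
      have h1 := h.detourCost_pairFun hB (h.normalize_mem hu) (h.lam_neg_normalize hB hu)
        (h.normalize_mem hv)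
      have h2 := h.detourCost_pairFun hB (h.normalize_mem hu) (h.lam_neg_normalize hB hu)
        (h.normalize_mem hu)
      change detourCost _ _ (partFun P Q u) (partFun P Q v) = _ at h1
      change detourCost _ _ (partFun P Q u) (partFun P Q u) = _ at h2
      rw [← huv, h2, EReal.coe_eq_coe_iff, sub_self, lam_zero hB h.idem_add h.ne_zero] at h1
      exact h1.symm
    have hz := eq_zero_of_lam_nonpos hB h.idem_add h.ne_zero (h.add_mul_of_mem
      (Submodule.sub_mem _ (h.normalize_mem hx) (h.normalize_mem hy))) (hcost hx hy heq).le
      (by rw [neg_sub]; exact (hcost hy hx heq.symm).le)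
    refine ⟨lam (P + Q) (-y) - lam (P + Q) (-x), ?_⟩
    rw [sub_smul, ← sub_eq_zero, ← neg_eq_zero, ← hz]
    abel
  · rintro ⟨s, hs⟩
    obtain rfl : x = s • (P + Q) + y := by rw [hs, sub_add_cancel]
    unfold partFun
    congr 1
    rw [neg_add, ← neg_smul, h.lam_smul_add hB (Submodule.neg_mem _ hy), add_smul, neg_smul]
    abel

/-- By the classification g has the same shape for some pair, and finite detour distance identifies
the pair. -/
theorem exists_eq_partFun (h : IsOrthPair P Q)
    (hB : IsAssocInner B) {a : V} (ha : a ∈ peirceSum P Q) {g : V → ℝ}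
    (hg : SamePart spectralDist 0 (pairFun P Q a) g) : ∃ x ∈ peirceSum P Q, g = partFun P Q x := by
  have := h.nontrivial
  obtain ⟨P', Q', b, h', hb, hn, rfl⟩ := exists_eq_pairFun hB hg.2.1.1
  obtain ⟨rfl, rfl⟩ := h.eq_of_detourDist_lt_top hB ha h' hb hg.2.2
  exact ⟨b, hb, (partFun_of_lam_neg hn).symm⟩

theorem samePart_partFun (h : IsOrthPair P Q)
    (hB : IsAssocInner B) {a x : V} (ha : a ∈ peirceSum P Q)
    (hn : lam (P + Q) (-a) = 0) (hx : x ∈ peirceSum P Q) :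
    SamePart spectralDist 0 (pairFun P Q a) (partFun P Q x) := by
  refine ⟨h.pairFun_mem_busemannPoints hB ha hn, h.partFun_mem_busemannPoints hB hx, ?_⟩
  rw [← partFun_of_lam_neg hn, h.detourDist_partFun hB ha hx]
  exact EReal.coe_lt_top _

theorem exists_partOf_equiv (h : IsOrthPair P Q)
    (hB : IsAssocInner B) {a : V} (ha : a ∈ peirceSum P Q)
    (hn : lam (P + Q) (-a) = 0) :
    ∃ ρ : partOf spectralDist 0 (pairFun P Q a) ≃ peirceQuotient P Q,
      ∀ (g g' : partOf spectralDist 0 (pairFun P Q a)) (x y : peirceSum P Q),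
        ρ g = Submodule.Quotient.mk x → ρ g' = Submodule.Quotient.mk y →
        detourDist spectralDist 0 (g : V → ℝ) (g' : V → ℝ) =
          (varNorm (peirceSum P Q) (P + Q) ((x : V) - (y : V)) : EReal) := by
  have hmk : ∀ x y : peirceSum P Q, (Submodule.Quotient.mk x : peirceQuotient P Q) =
      Submodule.Quotient.mk y ↔ partFun P Q x = partFun P Q y := by
    intro x y
    rw [h.partFun_eq_iff hB x.2 y.2]
    exact Submodule.Quotient.eq _
  have hsurj : Function.Surjective
      (Submodule.Quotient.mk : peirceSum P Q → peirceQuotient P Q) := Submodule.mkQ_surjective _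
  choose out hout using hsurj
  let f : peirceQuotient P Q → partOf spectralDist 0 (pairFun P Q a) := fun ξ =>
    ⟨partFun P Q (out ξ), h.samePart_partFun hB ha hn (out ξ).2⟩
  have hf : ∀ x : peirceSum P Q, (f (Submodule.Quotient.mk x) : V → ℝ) = partFun P Q x := fun x =>
    (hmk _ _).1 (hout _)
  have hbij : Function.Bijective f := by
    constructor
    · intro ξ η hξη
      rw [← hout ξ, ← hout η, hmk]
      exact congrArg Subtype.val hξη
    · rintro ⟨g, hg⟩
      obtain ⟨x, hx, rfl⟩ := h.exists_eq_partFun hB ha hg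
      exact ⟨Submodule.Quotient.mk ⟨x, hx⟩, Subtype.ext (hf ⟨x, hx⟩)⟩
  refine ⟨(Equiv.ofBijective f hbij).symm, fun g g' x y hx hy => ?_⟩
  rw [Equiv.symm_apply_eq] at hx hy
  rw [hx, hy]
  change detourDist _ _ (f _ : V → ℝ) (f _ : V → ℝ) = _
  rw [hf, hf, h.detourDist_partFun hB x.2 y.2]

end IsOrthPair

end Part

/-! ### The theorem for Jordan frames -/

theorem theorem4p2 {V : Type u} [NonAssocCommRing V] [Module ℝ V] [SMulCommClass ℝ V V]
    [IsScalarTower ℝ V V] [IsCommJordan V] [FiniteDimensional ℝ V] [IsEuclideanJordan V]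
    {r : ℕ} (p q : Fin r → V) (hp : IsJordanFrame p) (hq : IsJordanFrame q)
    (I J I' J' : Finset (Fin r)) (hIJ : Disjoint I J) (hIJ' : Disjoint I' J')
    (hne : (I ∪ J).Nonempty) (hne' : (I' ∪ J').Nonempty)
    (α β : Fin r → ℝ)
    (hα : IsLeast (α '' (I ∪ J : Finset (Fin r))) 0)
    (hβ : IsLeast (β '' (I' ∪ J' : Finset (Fin r))) 0)
    (h h' : V → ℝ) (hh : h = horoFun p I J α) (hh' : h' = horoFun q I' J' β)
    (pI pJ qI' qJ' a b : V)
    (hpI : pI = ∑ i ∈ I, p i) (hpJ : pJ = ∑ j ∈ J, p j)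
    (hqI' : qI' = ∑ i ∈ I', q i) (hqJ' : qJ' = ∑ j ∈ J', q j)
    (ha : a = ∑ i ∈ I, α i • p i + ∑ j ∈ J, α j • p j)
    (hb : b = ∑ i ∈ I', β i • q i + ∑ j ∈ J', β j • q j) :
    (SamePart spectralDist 0 h h' ↔ pI = qI' ∧ pJ = qJ') ∧
    (SamePart spectralDist 0 h h' →
      a ∈ peirceSum pI pJ ∧ b ∈ peirceSum pI pJ ∧
      detourDist spectralDist 0 h h' = (varNorm (peirceSum pI pJ) (pI + pJ) (a - b) : EReal)) ∧
    (∃ ρ : partOf spectralDist 0 h ≃ peirceQuotient pI pJ,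
      ∀ (g g' : partOf spectralDist 0 h) (x y : peirceSum pI pJ),
        ρ g = Submodule.Quotient.mk x → ρ g' = Submodule.Quotient.mk y →
        detourDist spectralDist 0 (g : V → ℝ) (g' : V → ℝ) =
          (varNorm (peirceSum pI pJ) (pI + pJ) ((x : V) - (y : V)) : EReal)) := by
  obtain ⟨B, hB1, hB2, hB3⟩ := IsEuclideanJordan.exists_inner (V := V)
  have hB : IsAssocInner B := ⟨hB1, hB2, hB3⟩
  rw [horoFun_eq_pairFun hB hp hIJ hne, ← hpI, ← hpJ, ← ha] at hh
  rw [horoFun_eq_pairFun hB hq hIJ' hne', ← hqI', ← hqJ', ← hb] at hh'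
  have hn := lam_neg_frame hB hp hIJ hne hα
  have hn' := lam_neg_frame hB hq hIJ' hne' hβ
  have hP := isOrthPair_of_frame hp hIJ hne
  have hQ := isOrthPair_of_frame hq hIJ' hne'
  have ham := sum_smul_mem_peirceSum hp hIJ hne α
  have hbm := sum_smul_mem_peirceSum hq hIJ' hne' β
  rw [← hpI, ← hpJ, ← ha] at hn ham
  rw [← hqI', ← hqJ', ← hb] at hn' hbm
  rw [← hpI, ← hpJ] at hP
  rw [← hqI', ← hqJ'] at hQ
  clear hpI hpJ ha hqI' hqJ' hb
  subst hh hh'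
  -- Equal pairs put both functions in one family with finite variation distance; the other
  -- direction is the rigidity of the pair.
  have hiff : SamePart spectralDist 0 (pairFun pI pJ a) (pairFun qI' qJ' b) ↔
      pI = qI' ∧ pJ = qJ' := by
    refine ⟨fun hs => hP.eq_of_detourDist_lt_top hB ham hQ hbm hs.2.2, ?_⟩
    rintro ⟨rfl, rfl⟩
    rw [← IsOrthPair.partFun_of_lam_neg hn']
    exact hP.samePart_partFun hB ham hn hbm
  refine ⟨hiff, fun hs => ?_, hP.exists_partOf_equiv hB ham hn⟩
  obtain ⟨rfl, rfl⟩ := hiff.1 hs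
  exact ⟨ham, hbm, hP.detourDist_pairFun hB ham hn hbm hn'⟩
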